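/- Let $N\ge 0$, let $\mathcal H_1,\dots,\mathcal H_N$ be finite-dimensional complex Hilbert spaces of dimensions $d_1,\dots,d_N$, let $\varepsilon_1,\dots,\varepsilon_N\in\{+1,-1\}$, put $\mathcal H=\bigoplus_{i=1}^N\mathcal H_i$ (orthogonal direct sum), and let $\mathcal L$ be a complex Hilbert space. An involutive R-matrix on a Hilbert space $\mathcal E$ is a unitary $T$ on $\mathcal E\otimes\mathcal E$ with $T^2=1$ and $(T\otimes 1)(1\otimes T)(T\otimes 1)=(1\otimes T)(T\otimes 1)(1\otimes T)$. It defines, for every $n\ge 0$, a unitary representation $D_n^T$ of the symmetric group $\mathfrak S_n$ on $\mathcal E^{\otimes n}$, in which the transposition of $k$ and $k+1$ acts as $T$ on the tensor factors $k,k+1$, and the orthogonal projection $P_n^T=\frac1{n!}\sum_{\pi\in\mathfrak S_n}D_n^T(\pi)$. The $T$-symmetrised Fock space is $\mathcal F_T(\mathcal E)=\bigoplus_{n\ge 0}P_n^T\mathcal E^{\otimes n}$ (Hilbert space direct sum). For $f_1,\dots,f_n\in\mathcal E$ write $[f_1,\dots,f_n]_T=\sqrt{n!}\,P_n^T(f_1\otimes\cdots\otimes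 f_n)\in\mathcal F_T(\mathcal E)$; this is $z_T^*(f_1)\cdots z_T^*(f_n)\Omega_T$, where $\Omega_T=1\in\mathcal E^{\otimes 0}=\mathbb C$ is the vacuum and $z_T^*(f)\psi_n=\sqrt{n+1}\,P_{n+1}^T(f\otimes\psi_n)$ are the creation operators. In particular, $[\,]_T=\Omega_T$ for the empty list. Let $S=\boxplus_{i=1}^N\varepsilon_i1_{d_i^2}$ be the involutive R-matrix of normal form on $\mathcal H$, that is, $S(x\otimes y)=\varepsilon_i\,x\otimes y$ for $x,y\in\mathcal H_i$, and $S(x\otimes y)=y\otimes x$ for $x\in\mathcal H_i$, $y\in\mathcal H_j$ with $i\ne j$. Write $\tilde{\mathcal H}=\mathcal H\otimes\mathcal L$ and $\tilde{\mathcal H}_i=\mathcal H_i\otimes\mathcal L\subset\tilde{\mathcal H}$. Let $\tilde S$ be the involutive R-matrix on $\tilde{\mathcal H}$ that acts as $S$ on $\mathcal H\otimes\mathcal H$ and as the tensor flip on $\mathcal L\otimes\mathcal L$, and let $\tilde\varepsilon_i$ be the involutive R-matrix on $\tilde{\mathcal H}_i$ obtained in the same way from $\varepsilon_i1_{d_i^2}$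 on $\mathcal H_i\otimes\mathcal H_i$. Then there is a unitary $$V:\mathcal F_{\tilde S}(\tilde{\mathcal H})\to\bigotimes_{i=1}^N\mathcal F_{\tilde\varepsilon_i}(\tilde{\mathcal H}_i)$$ onto the Hilbert space tensor product which maps the vacuum to the tensor product of the vacua and intertwines the creation operators: for all $n\ge0$, all $i_1,\dots,i_n\in\{1,\dots,N\}$ and all $f_k\in\tilde{\mathcal H}_{i_k}$ $(1\le k\le n)$, $$V\,[f_1,\dots,f_n]_{\tilde S}=\bigotimes_{i=1}^N\big[(f_k)_{k:\,i_k=i}\big]_{\tilde\varepsilon_i},$$ where $(f_k)_{k:\,i_k=i}$ lists the $f_k$ with $i_k=i$ in increasing order of $k$. -/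

import Mathlib

set_option maxSynthPendingDepth 3
open scoped TensorProduct
universe u v
namespace RFock


/-- The Coxeter presentation of the symmetric group: elements `s 0, s 1, …` of a group that satisfy
the Coxeter relations of the adjacent transpositions define a homomorphism on `Perm (Fin n)`. -/
theorem exists_permHom : ∀ (n : ℕ) {G : Type*} [Group G] (s : ℕ → G)
    (_ : ∀ k, k + 1 < n → s k * s k = 1)
    (_ : ∀ k, k + 2 < n → s k * s (k + 1) * s k = s (k + 1) * s k * s (k + 1))
    (_ : ∀ k l, k + 2 ≤ l → l + 1 < n → s k * s l = s l * s k),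
    ∃ f : Equiv.Perm (Fin n) →* G, ∀ (k : ℕ) (h : k + 1 < n),
      f (Equiv.swap ⟨k, by omega⟩ ⟨k + 1, h⟩) = s k := by
  intro n
  induction n with
  | zero => intro G _ s _ _ _; exact ⟨1, fun k h => by omega⟩
  | succ n ih =>
    intro G _ s h1 h2 h3
    obtain ⟨f', hf'⟩ := ih (fun k => s (k + 1)) (fun k hk => h1 _ (by omega))
      (fun k hk => h2 _ (by omega)) (fun k l hk hl => h3 _ _ (by omega) (by omega))
    let e : Equiv.Perm (Fin n) →* Equiv.Perm (Fin (n + 1)) :=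
      Equiv.Perm.viaEmbeddingHom (Fin.succEmb n)
    have he_succ : ∀ π x, e π (Fin.succ x) = Fin.succ (π x) := fun π x =>
      Equiv.Perm.viaEmbedding_apply π (Fin.succEmb n) x
    have he_zero : ∀ π, e π 0 = 0 := fun π =>
      Equiv.Perm.viaEmbedding_apply_of_notMem π (Fin.succEmb n) 0 (by
        rintro ⟨x, hx⟩
        exact Fin.succ_ne_zero x hx)
    let τ : ℕ → Equiv.Perm (Fin (n + 1)) := fun k =>
      if h : k + 1 < n + 1 then Equiv.swap ⟨k, by omega⟩ ⟨k + 1, h⟩ else 1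
    have hτ : ∀ k (h : k + 1 < n + 1), τ k = Equiv.swap ⟨k, by omega⟩ ⟨k + 1, h⟩ :=
      fun k h => dif_pos h
    let t : ℕ → Equiv.Perm (Fin (n + 1)) × G := fun k => (τ k, s k)
    let F : Equiv.Perm (Fin n) →* Equiv.Perm (Fin (n + 1)) × G := e.prod f'
    have hF : ∀ k (h : k + 1 < n), F (Equiv.swap ⟨k, by omega⟩ ⟨k + 1, h⟩) = t (k + 1) := by
      intro k h
      refine Prod.ext ?_ (hf' k h)
      change e _ = τ (k + 1)
      rw [hτ _ (by omega)]
      ext x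
      refine Fin.cases ?_ (fun x => ?_) x
      · rw [he_zero, Equiv.swap_apply_of_ne_of_ne] <;> simp [Fin.ext_iff]
      · rw [he_succ]
        simp only [Equiv.swap_apply_def, Fin.ext_iff, Fin.val_succ]
        split_ifs <;> simp_all
    have braid : ∀ a b c : Fin (n + 1), a ≠ b → a ≠ c → b ≠ c →
        Equiv.swap a b * Equiv.swap b c * Equiv.swap a b =
          Equiv.swap b c * Equiv.swap a b * Equiv.swap b c := by
      intro a b c hab hac hbc
      rw [Equiv.swap_mul_swap_mul_swap hab hac, Equiv.swap_comm a b, Equiv.swap_comm b c,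
        Equiv.swap_mul_swap_mul_swap hbc.symm hac.symm, Equiv.swap_comm]
    have t1 : ∀ k, k < n → t k * t k = 1 := fun k hk => by
      refine Prod.ext ?_ (h1 k (by omega))
      change τ k * τ k = 1
      rw [hτ _ (by omega), Equiv.swap_mul_self]
    have t2 : ∀ k, k + 1 < n → t k * t (k + 1) * t k = t (k + 1) * t k * t (k + 1) := by
      intro k hk
      refine Prod.ext ?_ (h2 k (by omega))
      change τ k * τ (k + 1) * τ k = τ (k + 1) * τ k * τ (k + 1)
      rw [hτ k (by omega), hτ (k + 1) (by omega)]
      exact braid _ _ _ (by simp [Fin.ext_iff]) (by simp [Fin.ext_iff]; omega) (by simp [Fin.ext_iff])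
    have t3 : ∀ k l, k + 2 ≤ l → l < n → t k * t l = t l * t k := by
      intro k l hk hl
      refine Prod.ext ?_ (h3 k l hk (by omega))
      change τ k * τ l = τ l * τ k
      rw [hτ k (by omega), hτ l (by omega)]
      refine (Equiv.Perm.disjoint_iff_disjoint_support.mpr ?_).commute
      rw [Equiv.Perm.support_swap (by simp [Fin.ext_iff]),
        Equiv.Perm.support_swap (by simp [Fin.ext_iff])]
      simp only [Finset.disjoint_insert_left, Finset.disjoint_singleton_left, Finset.mem_insert,
        Finset.mem_singleton, Fin.mk.injEq]
      omega
    let C : ℕ → Equiv.Perm (Fin (n + 1)) × G := fun p => Nat.rec 1 (fun q c => t q * c) p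
    have C0 : C 0 = 1 := rfl
    have CS : ∀ p, C (p + 1) = t p * C p := fun p => rfl
    have c1 : ∀ p k, p + 1 ≤ k → k < n → t k * C p = C p * t k := by
      intro p
      induction p with
      | zero => intro k _ _; rw [C0, one_mul, mul_one]
      | succ p ihp =>
        intro k hk hkn
        rw [CS, ← mul_assoc, ← t3 p k (by omega) hkn, mul_assoc, ihp k (by omega) hkn, mul_assoc]
    have c4 : ∀ p k, k + 2 ≤ p → p ≤ n → t k * C p = C p * t (k + 1) := by
      intro p k hk
      induction p, hk using Nat.le_induction with
      | base =>
        intro hp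
        rw [CS (k + 1), CS k, ← mul_assoc, ← mul_assoc, t2 k (by omega), mul_assoc,
          c1 k (k + 1) le_rfl (by omega)]
        simp only [mul_assoc]
      | succ p hp ihp =>
        intro hpn
        rw [CS, ← mul_assoc, t3 k p hp (by omega), mul_assoc, ihp (by omega), mul_assoc]
    have Cval : ∀ p (hp : p ≤ n), (C p).1 0 = ⟨p, by omega⟩ := by
      intro p
      induction p with
      | zero => intro _; rfl
      | succ p ihp =>
        intro hp
        change τ p ((C p).1 0) = _
        rw [ihp (by omega), hτ p (by omega), Equiv.swap_apply_left]
    let T : Set (Equiv.Perm (Fin (n + 1)) × G) := {x | ∃ p ≤ n, ∃ π, x = C p * F π}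
    have hT : ∀ k, k < n → ∀ x ∈ T, t k * x ∈ T := by
      rintro k hk x ⟨p, hp, π, rfl⟩
      rcases lt_trichotomy k p with h | h | h
      · rcases Nat.lt_or_ge (k + 1) p with h' | h'
        · refine ⟨p, hp, Equiv.swap ⟨k, by omega⟩ ⟨k + 1, by omega⟩ * π, ?_⟩
          rw [map_mul, hF k (by omega), ← mul_assoc, c4 p k h' hp, mul_assoc]
        · obtain rfl : p = k + 1 := by omega
          refine ⟨k, by omega, π, ?_⟩
          rw [CS, ← mul_assoc, ← mul_assoc, t1 k hk, one_mul]
      · subst h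
        exact ⟨k + 1, by omega, π, by rw [CS, mul_assoc]⟩
      · obtain ⟨j, rfl⟩ : ∃ j, k = j + 1 := ⟨k - 1, by omega⟩
        refine ⟨p, hp, Equiv.swap ⟨j, by omega⟩ ⟨j + 1, by omega⟩ * π, ?_⟩
        rw [map_mul, hF j (by omega), ← mul_assoc, c1 p (j + 1) (by omega) hk, mul_assoc]
    let Γ : Submonoid (Equiv.Perm (Fin (n + 1)) × G) :=
      Submonoid.closure {x | ∃ k, k < n ∧ x = t k}
    have hΓT : ∀ x ∈ Γ, x ∈ T := by
      intro x hx
      induction hx using Submonoid.closure_induction_left with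
      | one => exact ⟨0, by omega, 1, by rw [C0, map_one, one_mul]⟩
      | mul_left x hx y hy ihy =>
        obtain ⟨k, hk, rfl⟩ := hx
        exact hT k hk y ihy
    have hker : ∀ g : G, ((1 : Equiv.Perm (Fin (n + 1))), g) ∈ Γ → g = 1 := by
      intro g hg
      obtain ⟨p, hp, π, h⟩ := hΓT _ hg
      have ha : (1 : Equiv.Perm (Fin (n + 1))) = (C p).1 * e π := congrArg Prod.fst h
      have hb : g = (C p).2 * f' π := congrArg Prod.snd h
      have hp0 : p = 0 := by
        have := congrArg (fun σ : Equiv.Perm (Fin (n + 1)) => σ 0) ha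
        simp only [Equiv.Perm.mul_apply, he_zero, Cval p hp, Equiv.Perm.one_apply] at this
        exact (congrArg Fin.val this).symm
      subst hp0
      have hπ : π = 1 := by
        ext x
        have := congrArg (fun σ : Equiv.Perm (Fin (n + 1)) => σ x.succ) ha
        simp only [Equiv.Perm.mul_apply, he_succ, Equiv.Perm.one_apply, C0, Prod.fst_one] at this
        exact (congrArg Fin.val (Fin.succ_injective _ this)).symm
      rw [hb, hπ, map_one, mul_one]
      rfl
    have hex : ∀ π : Equiv.Perm (Fin (n + 1)), ∃ g : G, (π, g) ∈ Γ := by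
      intro π
      have hπ : π ∈ Submonoid.closure
          (Set.range fun i : Fin n => Equiv.swap i.castSucc i.succ) := by
        rw [Equiv.Perm.mclosure_swap_castSucc_succ]; trivial
      induction hπ using Submonoid.closure_induction with
      | mem x hx =>
        obtain ⟨i, rfl⟩ := hx
        refine ⟨s i, ?_⟩
        have : (Equiv.swap i.castSucc i.succ, s i) = t i := by
          refine Prod.ext ?_ rfl
          change _ = τ i
          rw [hτ i (by omega)]
          rfl
        rw [this]
        exact Submonoid.subset_closure ⟨i, i.2, rfl⟩
      | one => exact ⟨1, Γ.one_mem⟩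
      | mul x y _ _ hx hy =>
        obtain ⟨a, ha⟩ := hx
        obtain ⟨b, hb⟩ := hy
        exact ⟨a * b, Γ.mul_mem ha hb⟩
    choose g hg using hex
    have huniq : ∀ π a, (π, a) ∈ Γ → g π = a := by
      intro π a ha
      have h' := Γ.mul_mem ha (hg π⁻¹)
      have h'' := Γ.mul_mem (hg π) (hg π⁻¹)
      rw [Prod.mk_mul_mk, mul_inv_cancel] at h' h''
      exact mul_right_cancel ((hker _ h'').trans (hker _ h').symm)
    refine ⟨⟨⟨g, huniq 1 1 Γ.one_mem⟩, fun x y => huniq _ _ (Γ.mul_mem (hg x) (hg y))⟩, ?_⟩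
    intro k h
    refine huniq _ _ ?_
    rw [← hτ k h]
    exact Submonoid.subset_closure ⟨k, by omega, rfl⟩

/-- A bundled complex inner product space. -/
structure PreHilb : Type (u + 1) where
  carrier : Type u
  [group : NormedAddCommGroup carrier]
  [inner : InnerProductSpace ℂ carrier]

attribute [instance] PreHilb.group PreHilb.inner

/-- The iterated algebraic tensor product `E 0 ⊗ (E 1 ⊗ (⋯ ⊗ ℂ))` with its inner product
`⟨x₀ ⊗ x₁ ⊗ ⋯, y₀ ⊗ y₁ ⊗ ⋯⟩ = ∏ i, ⟨x i, y i⟩`; the empty tensor product is the scalar field. -/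
noncomputable def iterTensor : (n : ℕ) → (E : Fin n → Type u) →
    [∀ i, NormedAddCommGroup (E i)] → [∀ i, InnerProductSpace ℂ (E i)] → PreHilb.{u}
  | 0, _, _, _ => ⟨EuclideanSpace ℂ PUnit.{u + 1}⟩
  | n + 1, E, _, _ => ⟨E 0 ⊗[ℂ] (iterTensor n fun i => E i.succ).carrier⟩

/-- The algebraic tensor product of finitely many inner product spaces. -/
abbrev AlgTensor {n : ℕ} (E : Fin n → Type u) [∀ i, NormedAddCommGroup (E i)]
    [∀ i, InnerProductSpace ℂ (E i)] : Type u := (iterTensor n E).carrier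

/-- The defining identification `E 0 ⊗ (E 1 ⊗ ⋯) = E 0 ⊗ E 1 ⊗ ⋯`. -/
noncomputable def AlgTensor.succIso {n : ℕ} (E : Fin (n + 1) → Type u)
    [∀ i, NormedAddCommGroup (E i)] [∀ i, InnerProductSpace ℂ (E i)] :
    (E 0 ⊗[ℂ] AlgTensor fun i : Fin n => E i.succ) ≃ₗᵢ[ℂ] AlgTensor E :=
  LinearIsometryEquiv.refl ℂ (E 0 ⊗[ℂ] AlgTensor fun i : Fin n => E i.succ)

/-- The elementary tensor `x 0 ⊗ x 1 ⊗ ⋯`. -/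
noncomputable def AlgTensor.tprod : {n : ℕ} → {E : Fin n → Type u} →
    [∀ i, NormedAddCommGroup (E i)] → [∀ i, InnerProductSpace ℂ (E i)] →
    (∀ i, E i) → AlgTensor E
  | 0, _, _, _, _ => EuclideanSpace.single PUnit.unit (1 : ℂ)
  | _ + 1, E, _, _, x => AlgTensor.succIso E (x 0 ⊗ₜ[ℂ] AlgTensor.tprod fun i => x i.succ)

theorem AlgTensor.inner_tprod : ∀ {n : ℕ} {E : Fin n → Type u}
    [∀ i, NormedAddCommGroup (E i)] [∀ i, InnerProductSpace ℂ (E i)] (x y : ∀ i, E i),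
    inner ℂ (AlgTensor.tprod x) (AlgTensor.tprod y) = ∏ i, inner ℂ (x i) (y i)
  | 0, E, _, _, x, y => by
    change inner ℂ (EuclideanSpace.single PUnit.unit (1 : ℂ)) (EuclideanSpace.single PUnit.unit (1 : ℂ)) = _
    simp
  | n + 1, E, _, _, x, y => by
    rw [AlgTensor.tprod, AlgTensor.tprod, LinearIsometryEquiv.inner_map_map,
      TensorProduct.inner_tmul, AlgTensor.inner_tprod, Fin.prod_univ_succ]

/-- The Hilbert space tensor product of finitely many inner product spaces: the completion of their
algebraic tensor product. -/
abbrev HilbTensor {n : ℕ} (E : Fin n → Type u) [∀ i, NormedAddCommGroup (E i)]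
    [∀ i, InnerProductSpace ℂ (E i)] : Type u := UniformSpace.Completion (AlgTensor E)

/-- The elementary tensor `x 0 ⊗ x 1 ⊗ ⋯` in the Hilbert space tensor product. -/
noncomputable def HilbTensor.tprod {n : ℕ} {E : Fin n → Type u} [∀ i, NormedAddCommGroup (E i)]
    [∀ i, InnerProductSpace ℂ (E i)] (x : ∀ i, E i) : HilbTensor E :=
  (AlgTensor.tprod x : AlgTensor E)

section
variable (E : Type u) [NormedAddCommGroup E] [InnerProductSpace ℂ E]

/-- The algebraic `n`-th tensor power of `E`. -/
abbrev TPow (n : ℕ) : Type u := AlgTensor fun _ : Fin n => E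

/-- The identification `E ⊗ E^{⊗ n} = E^{⊗ (n + 1)}`. -/
noncomputable def TPow.succIso (n : ℕ) : (E ⊗[ℂ] TPow E n) ≃ₗᵢ[ℂ] TPow E (n + 1) :=
  AlgTensor.succIso fun _ : Fin (n + 1) => E

end

section
variable {E : Type u} [NormedAddCommGroup E] [InnerProductSpace ℂ E]

/-- The operator `S ⊗ 1` on `E ⊗ E ⊗ T`. -/
noncomputable def leftLeg (S : (E ⊗[ℂ] E) ≃ₗᵢ[ℂ] (E ⊗[ℂ] E)) (T : Type v) [NormedAddCommGroup T]
    [InnerProductSpace ℂ T] : (E ⊗[ℂ] (E ⊗[ℂ] T)) ≃ₗᵢ[ℂ] (E ⊗[ℂ] (E ⊗[ℂ] T)) :=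
  ((TensorProduct.assocIsometry ℂ E E T).symm.trans (S.rTensor T)).trans
    (TensorProduct.assocIsometry ℂ E E T)

/-- Given `A` on the `n`-th tensor power, the operator `1 ⊗ A` on the `(n + 1)`-st tensor power. -/
noncomputable def shift {n : ℕ} (A : TPow E n ≃ₗᵢ[ℂ] TPow E n) :
    TPow E (n + 1) ≃ₗᵢ[ℂ] TPow E (n + 1) :=
  ((TPow.succIso E n).symm.trans (A.lTensor E)).trans (TPow.succIso E n)

/-- The identification `E ⊗ (E ⊗ E^{⊗ n}) = E^{⊗ (n + 2)}`. -/
noncomputable def twoIso (n : ℕ) : (E ⊗[ℂ] (E ⊗[ℂ] TPow E n)) ≃ₗᵢ[ℂ] TPow E (n + 2) :=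
  ((TPow.succIso E n).lTensor E).trans (TPow.succIso E (n + 1))

/-- The operator `S ⊗ 1` on `E^{⊗ (n + 2)}`, with `S` acting on the first two factors. -/
noncomputable def firstLeg (S : (E ⊗[ℂ] E) ≃ₗᵢ[ℂ] (E ⊗[ℂ] E)) (n : ℕ) :
    TPow E (n + 2) ≃ₗᵢ[ℂ] TPow E (n + 2) :=
  ((twoIso n).symm.trans (leftLeg S (TPow E n))).trans (twoIso n)

/-- The operator `1^{⊗ k} ⊗ S ⊗ 1^{⊗ (n - k - 2)}` on `E^{⊗ n}`, acting on the tensor factors `k`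
and `k + 1` (counted from `0`); it is only meaningful for `k + 1 < n`. -/
noncomputable def leg (S : (E ⊗[ℂ] E) ≃ₗᵢ[ℂ] (E ⊗[ℂ] E)) : (n k : ℕ) → TPow E n ≃ₗᵢ[ℂ] TPow E n
  | 0, _ => 1
  | 1, 0 => 1
  | n + 2, 0 => firstLeg S n
  | n + 1, k + 1 => shift (leg S n k)

/-- The operator `S ⊗ 1` on `(E ⊗ E) ⊗ E`. -/
noncomputable def left3 (S : (E ⊗[ℂ] E) ≃ₗᵢ[ℂ] (E ⊗[ℂ] E)) :
    ((E ⊗[ℂ] E) ⊗[ℂ] E) ≃ₗᵢ[ℂ] ((E ⊗[ℂ] E) ⊗[ℂ] E) := S.rTensor E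

/-- The operator `1 ⊗ S` on `(E ⊗ E) ⊗ E`. -/
noncomputable def right3 (S : (E ⊗[ℂ] E) ≃ₗᵢ[ℂ] (E ⊗[ℂ] E)) :
    ((E ⊗[ℂ] E) ⊗[ℂ] E) ≃ₗᵢ[ℂ] ((E ⊗[ℂ] E) ⊗[ℂ] E) :=
  ((TensorProduct.assocIsometry ℂ E E E).trans (S.lTensor E)).trans
    (TensorProduct.assocIsometry ℂ E E E).symm

theorem left3_tmul (S : (E ⊗[ℂ] E) ≃ₗᵢ[ℂ] (E ⊗[ℂ] E)) (w : E ⊗[ℂ] E) (z : E) :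
    left3 S (w ⊗ₜ z) = S w ⊗ₜ z := rfl

theorem right3_assoc_symm (S : (E ⊗[ℂ] E) ≃ₗᵢ[ℂ] (E ⊗[ℂ] E)) (z : E) (w : E ⊗[ℂ] E) :
    right3 S ((TensorProduct.assoc ℂ E E E).symm (z ⊗ₜ w)) =
      (TensorProduct.assoc ℂ E E E).symm (z ⊗ₜ S w) := by
  change (TensorProduct.assoc ℂ E E E).symm (S.lTensor E ((TensorProduct.assoc ℂ E E E)
    ((TensorProduct.assoc ℂ E E E).symm (z ⊗ₜ w)))) = _
  rw [LinearEquiv.apply_symm_apply]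
  rfl

theorem right3_tmul (S : (E ⊗[ℂ] E) ≃ₗᵢ[ℂ] (E ⊗[ℂ] E)) (x y z : E) :
    right3 S ((x ⊗ₜ y) ⊗ₜ z) =
      (TensorProduct.assoc ℂ E E E).symm (x ⊗ₜ S (y ⊗ₜ z)) :=
  right3_assoc_symm S x (y ⊗ₜ z)

/-- An involutive R-matrix on `E`: a unitary `S` on `E ⊗ E` with `S² = 1` (hence `S = S* = S⁻¹`)
that solves the Yang-Baxter equation `(S ⊗ 1)(1 ⊗ S)(S ⊗ 1) = (1 ⊗ S)(S ⊗ 1)(1 ⊗ S)`.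
If `E` is infinite-dimensional, these are the involutive R-matrices on the Hilbert space tensor
square that leave the algebraic tensor square invariant; each of them extends uniquely by
continuity. -/
structure InvRMatrix (E : Type u) [NormedAddCommGroup E] [InnerProductSpace ℂ E] where
  op : (E ⊗[ℂ] E) ≃ₗᵢ[ℂ] (E ⊗[ℂ] E)
  invol : ∀ x, op (op x) = x
  ybe : ∀ x, left3 op (right3 op (left3 op x)) = right3 op (left3 op (right3 op x))

theorem leftLeg_tmul (S : (E ⊗[ℂ] E) ≃ₗᵢ[ℂ] (E ⊗[ℂ] E)) {T : Type v} [NormedAddCommGroup T]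
    [InnerProductSpace ℂ T] (w : E ⊗[ℂ] E) (t : T) :
    leftLeg S T (TensorProduct.assoc ℂ E E T (w ⊗ₜ t)) = TensorProduct.assoc ℂ E E T (S w ⊗ₜ t) := by
  simp [leftLeg]

theorem leftLeg_invol (S : InvRMatrix E) (T : Type v) [NormedAddCommGroup T]
    [InnerProductSpace ℂ T] (x : E ⊗[ℂ] (E ⊗[ℂ] T)) :
    leftLeg S.op T (leftLeg S.op T x) = x := by
  obtain ⟨y, rfl⟩ := (TensorProduct.assoc ℂ E E T).surjective x
  induction y using TensorProduct.induction_on with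
  | zero => simp only [map_zero]
  | add a b ha hb => simp only [map_add, ha, hb]
  | tmul w t => simp only [leftLeg_tmul, S.invol]

theorem leftLeg_comm (S : (E ⊗[ℂ] E) ≃ₗᵢ[ℂ] (E ⊗[ℂ] E)) {T : Type v} [NormedAddCommGroup T]
    [InnerProductSpace ℂ T] (A : T ≃ₗᵢ[ℂ] T) (x : E ⊗[ℂ] (E ⊗[ℂ] T)) :
    leftLeg S T ((A.lTensor E).lTensor E x) = (A.lTensor E).lTensor E (leftLeg S T x) := by
  have key : ∀ (w : E ⊗[ℂ] E) (t : T), (A.lTensor E).lTensor E (TensorProduct.assoc ℂ E E T (w ⊗ₜ t))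
      = TensorProduct.assoc ℂ E E T (w ⊗ₜ A t) := by
    intro w t
    induction w using TensorProduct.induction_on with
    | zero => simp
    | add a b ha hb => simp only [TensorProduct.add_tmul, map_add, ha, hb]
    | tmul a b => simp
  obtain ⟨y, rfl⟩ := (TensorProduct.assoc ℂ E E T).surjective x
  induction y using TensorProduct.induction_on with
  | zero => simp only [map_zero]
  | add a b ha hb => simp only [map_add, ha, hb]
  | tmul w t => simp only [leftLeg_tmul, key]

theorem leftLeg_braid (S : InvRMatrix E) (T : Type v) [NormedAddCommGroup T]
    [InnerProductSpace ℂ T] (x : E ⊗[ℂ] (E ⊗[ℂ] (E ⊗[ℂ] T))) :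
    let A : (E ⊗[ℂ] (E ⊗[ℂ] (E ⊗[ℂ] T))) ≃ₗᵢ[ℂ] (E ⊗[ℂ] (E ⊗[ℂ] (E ⊗[ℂ] T))) :=
      (leftLeg S.op T).lTensor E
    leftLeg S.op (E ⊗[ℂ] T) (A (leftLeg S.op (E ⊗[ℂ] T) x)) =
      A (leftLeg S.op (E ⊗[ℂ] T) (A x)) := by
  intro A
  let c : (((E ⊗[ℂ] E) ⊗[ℂ] E) ⊗[ℂ] T) ≃ₗ[ℂ] (E ⊗[ℂ] (E ⊗[ℂ] (E ⊗[ℂ] T))) :=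
    (TensorProduct.assoc ℂ (E ⊗[ℂ] E) E T).trans (TensorProduct.assoc ℂ E E (E ⊗[ℂ] T))
  have h12 : ∀ (y : (E ⊗[ℂ] E) ⊗[ℂ] E) (t : T),
      leftLeg S.op (E ⊗[ℂ] T) (c (y ⊗ₜ t)) = c (S.op.rTensor E y ⊗ₜ t) := by
    intro y t
    induction y using TensorProduct.induction_on with
    | zero => simp only [TensorProduct.zero_tmul, map_zero]
    | add a b ha hb => simp only [TensorProduct.add_tmul, map_add, ha, hb]
    | tmul w z =>
      change leftLeg S.op (E ⊗[ℂ] T) (TensorProduct.assoc ℂ E E (E ⊗[ℂ] T) (w ⊗ₜ (z ⊗ₜ t))) =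
        TensorProduct.assoc ℂ E E (E ⊗[ℂ] T) (S.op w ⊗ₜ (z ⊗ₜ t))
      rw [leftLeg_tmul]
  have hc : ∀ (a : E) (w : E ⊗[ℂ] E) (t : T),
      c ((TensorProduct.assoc ℂ E E E).symm (a ⊗ₜ w) ⊗ₜ t) =
        a ⊗ₜ TensorProduct.assoc ℂ E E T (w ⊗ₜ t) := by
    intro a w t
    induction w using TensorProduct.induction_on with
    | zero => simp only [TensorProduct.zero_tmul, TensorProduct.tmul_zero, map_zero]
    | add p q hp hq => simp only [TensorProduct.add_tmul, TensorProduct.tmul_add, map_add, hp, hq]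
    | tmul p q => rfl
  have h23 : ∀ (y : (E ⊗[ℂ] E) ⊗[ℂ] E) (t : T),
      A (c (y ⊗ₜ t)) =
        c ((TensorProduct.assocIsometry ℂ E E E).symm
          (S.op.lTensor E (TensorProduct.assocIsometry ℂ E E E y)) ⊗ₜ t) := by
    intro y t
    obtain ⟨y, rfl⟩ := (TensorProduct.assocIsometry ℂ E E E).symm.surjective y
    induction y using TensorProduct.induction_on with
    | zero => simp only [TensorProduct.zero_tmul, map_zero]
    | add a b ha hb => simp only [TensorProduct.add_tmul, map_add, ha, hb]
    | tmul a w =>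
      rw [LinearIsometryEquiv.apply_symm_apply]
      change A (c ((TensorProduct.assoc ℂ E E E).symm (a ⊗ₜ w) ⊗ₜ t)) =
        c ((TensorProduct.assoc ℂ E E E).symm (a ⊗ₜ S.op w) ⊗ₜ t)
      rw [hc, hc, ← leftLeg_tmul]
      rfl
  obtain ⟨y, rfl⟩ := c.surjective x
  induction y using TensorProduct.induction_on with
  | zero => simp only [map_zero]
  | add a b ha hb => simp only [map_add, ha, hb]
  | tmul y t =>
    simp only [h12, h23]
    exact congrArg (fun z => c (z ⊗ₜ[ℂ] t)) (S.ybe y)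

theorem shift_mul {n : ℕ} (A B : TPow E n ≃ₗᵢ[ℂ] TPow E n) :
    shift (A * B) = shift A * shift B := by
  have h : ∀ y, (A * B).lTensor E y = A.lTensor E (B.lTensor E y) := by
    intro y
    induction y using TensorProduct.induction_on with
    | zero => simp only [map_zero]
    | add a b ha hb => simp only [map_add, ha, hb]
    | tmul a w => rfl
  ext x
  simp only [shift, LinearIsometryEquiv.coe_mul, Function.comp_apply,
    LinearIsometryEquiv.trans_apply, LinearIsometryEquiv.symm_apply_apply, h]

theorem shift_one {n : ℕ} : shift (1 : TPow E n ≃ₗᵢ[ℂ] TPow E n) = 1 := by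
  have h := shift_mul (1 : TPow E n ≃ₗᵢ[ℂ] TPow E n) 1
  rw [one_mul] at h
  exact left_eq_mul.mp h

theorem firstLeg_invol (S : InvRMatrix E) (n : ℕ) : firstLeg S.op n * firstLeg S.op n = 1 := by
  ext x
  simp only [firstLeg, LinearIsometryEquiv.coe_mul, Function.comp_apply,
    LinearIsometryEquiv.trans_apply, LinearIsometryEquiv.symm_apply_apply, leftLeg_invol,
    LinearIsometryEquiv.apply_symm_apply, LinearIsometryEquiv.coe_one, id]

theorem shift_shift_apply {n : ℕ} (A : TPow E n ≃ₗᵢ[ℂ] TPow E n) (x : E ⊗[ℂ] (E ⊗[ℂ] TPow E n)) :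
    shift (shift A) (twoIso n x) = twoIso n ((A.lTensor E).lTensor E x) := by
  induction x using TensorProduct.induction_on with
  | zero => simp only [map_zero]
  | add a b ha hb => simp only [map_add, ha, hb]
  | tmul a w => rfl

theorem firstLeg_apply (S : (E ⊗[ℂ] E) ≃ₗᵢ[ℂ] (E ⊗[ℂ] E)) (n : ℕ) (x : E ⊗[ℂ] (E ⊗[ℂ] TPow E n)) :
    firstLeg S n (twoIso n x) = twoIso n (leftLeg S _ x) := by
  simp only [firstLeg, LinearIsometryEquiv.trans_apply, LinearIsometryEquiv.symm_apply_apply]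

theorem firstLeg_comm (S : (E ⊗[ℂ] E) ≃ₗᵢ[ℂ] (E ⊗[ℂ] E)) {n : ℕ} (A : TPow E n ≃ₗᵢ[ℂ] TPow E n) :
    firstLeg S n * shift (shift A) = shift (shift A) * firstLeg S n := by
  ext x
  obtain ⟨x, rfl⟩ := (twoIso n).surjective x
  simp only [LinearIsometryEquiv.coe_mul, Function.comp_apply, shift_shift_apply, firstLeg_apply,
    leftLeg_comm]

theorem firstLeg_braid (S : InvRMatrix E) (n : ℕ) :
    firstLeg S.op (n + 1) * shift (firstLeg S.op n) * firstLeg S.op (n + 1) =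
      shift (firstLeg S.op n) * firstLeg S.op (n + 1) * shift (firstLeg S.op n) := by
  let d : (E ⊗[ℂ] (E ⊗[ℂ] (E ⊗[ℂ] TPow E n))) ≃ₗᵢ[ℂ] TPow E (n + 3) :=
    (((TPow.succIso E n).lTensor E).lTensor E).trans (twoIso (n + 1))
  let A : (E ⊗[ℂ] (E ⊗[ℂ] (E ⊗[ℂ] TPow E n))) ≃ₗᵢ[ℂ] (E ⊗[ℂ] (E ⊗[ℂ] (E ⊗[ℂ] TPow E n))) :=
      (leftLeg S.op (TPow E n)).lTensor E
  have h1 : ∀ x, shift (firstLeg S.op n) (d x) = d (A x) := by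
    intro x
    induction x using TensorProduct.induction_on with
    | zero => simp only [map_zero]
    | add a b ha hb => simp only [map_add, ha, hb]
    | tmul a w =>
      change TPow.succIso E (n + 2) (a ⊗ₜ firstLeg S.op n (twoIso n w)) =
        TPow.succIso E (n + 2) (a ⊗ₜ twoIso n (leftLeg S.op _ w))
      rw [firstLeg_apply]
  have h2 : ∀ x, firstLeg S.op (n + 1) (d x) = d (leftLeg S.op (E ⊗[ℂ] TPow E n) x) := by
    intro x
    have hd : ∀ y, d y = twoIso (n + 1) y := by
      intro y
      induction y using TensorProduct.induction_on with
      | zero => simp only [map_zero]; rfl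
      | add a b ha hb => rw [map_add, ha, hb]; exact (map_add _ _ _).symm
      | tmul a w => 
        induction w using TensorProduct.induction_on with
        | zero => simp only [TensorProduct.tmul_zero, map_zero]; rfl
        | add p q hp hq => rw [TensorProduct.tmul_add, map_add, hp, hq]; exact (map_add _ _ _).symm
        | tmul b z => rfl
    rw [hd, hd]
    exact firstLeg_apply _ _ _
  ext x
  obtain ⟨x, rfl⟩ := d.surjective x
  simp only [LinearIsometryEquiv.coe_mul, Function.comp_apply, h1, h2]
  exact congrArg d (leftLeg_braid S (TPow E n) x)

theorem leg_succ_succ (S : (E ⊗[ℂ] E) ≃ₗᵢ[ℂ] (E ⊗[ℂ] E)) (n k : ℕ) :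
    leg S (n + 1) (k + 1) = shift (leg S n k) := by
  cases n <;> rfl

theorem leg_invol (S : InvRMatrix E) : ∀ n k, leg S.op n k * leg S.op n k = 1
  | 0, _ => mul_one (1 : TPow E 0 ≃ₗᵢ[ℂ] TPow E 0)
  | 1, 0 => mul_one (1 : TPow E 1 ≃ₗᵢ[ℂ] TPow E 1)
  | n + 2, 0 => firstLeg_invol S n
  | n + 1, k + 1 => by
    rw [leg_succ_succ, ← shift_mul, leg_invol S n k, shift_one]

theorem leg_braid (S : InvRMatrix E) : ∀ n k, k + 2 < n →
    leg S.op n k * leg S.op n (k + 1) * leg S.op n k =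
      leg S.op n (k + 1) * leg S.op n k * leg S.op n (k + 1)
  | 0, _, h => by omega
  | 1, 0, h => by omega
  | 2, 0, h => by omega
  | n + 3, 0, h => firstLeg_braid S n
  | n + 1, k + 1, h => by
    simp only [leg_succ_succ, ← shift_mul, leg_braid S n k (by omega)]

theorem leg_comm (S : InvRMatrix E) : ∀ n k l, k + 2 ≤ l → l + 1 < n →
    leg S.op n k * leg S.op n l = leg S.op n l * leg S.op n k
  | 0, _, _, h, h' => by omega
  | 1, 0, _, h, h' => by omega
  | n + 2, 0, l + 2, h, h' => by
    rw [leg_succ_succ, leg_succ_succ]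
    exact firstLeg_comm S.op (leg S.op n l)
  | n + 1, k + 1, l + 1, h, h' => by
    simp only [leg_succ_succ, ← shift_mul, leg_comm S n k l (by omega) (by omega)]

theorem exists_permRep (S : InvRMatrix E) (n : ℕ) :
    ∃ D : Equiv.Perm (Fin n) →* (TPow E n ≃ₗᵢ[ℂ] TPow E n), ∀ (k : ℕ) (h : k + 1 < n),
      D (Equiv.swap ⟨k, by omega⟩ ⟨k + 1, h⟩) = leg S.op n k :=
  exists_permHom n (leg S.op n) (fun k _ => leg_invol S n k) (leg_braid S n) (leg_comm S n)

/-- The unitary representation `D_n` of the symmetric group on the `n`-th tensor power, determined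
by sending the transposition of `k` and `k + 1` to `S` acting on the factors `k` and `k + 1`. -/
noncomputable def permRep (S : InvRMatrix E) (n : ℕ) :
    Equiv.Perm (Fin n) →* (TPow E n ≃ₗᵢ[ℂ] TPow E n) :=
  (exists_permRep S n).choose

theorem permRep_swap (S : InvRMatrix E) (n k : ℕ) (h : k + 1 < n) :
    permRep S n (Equiv.swap ⟨k, by omega⟩ ⟨k + 1, h⟩) = leg S.op n k :=
  (exists_permRep S n).choose_spec k h

/-- The projection `P_n = (1 / n!) ∑_π D_n(π)`. -/
noncomputable def symProj (S : InvRMatrix E) (n : ℕ) : TPow E n →L[ℂ] TPow E n :=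
  (n.factorial : ℂ)⁻¹ • ∑ π : Equiv.Perm (Fin n),
    ((permRep S n π).toContinuousLinearEquiv : TPow E n →L[ℂ] TPow E n)

/-- The `n`-particle space: the range of `P_n` in the Hilbert space tensor power `E^{⊗ n}`. -/
noncomputable def symSpace (S : InvRMatrix E) (n : ℕ) :
    Submodule ℂ (HilbTensor fun _ : Fin n => E) :=
  (symProj S n).completion.range

/-- The `S`-symmetrised Fock space, the Hilbert space direct sum of the `n`-particle spaces. -/
abbrev Fock (S : InvRMatrix E) : Type u := lp (fun n => symSpace S n) 2

/-- The vector `√(n!) P_n (f₁ ⊗ ⋯ ⊗ f_n)` of the `n`-particle space, for a list `f₁, …, f_n`. It is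
`z*(f₁) ⋯ z*(f_n) Ω`, where the creation operators are `z*(f) ψ_n = √(n + 1) P_{n+1} (f ⊗ ψ_n)` and
`Ω` is the vacuum; the empty list gives `Ω`. -/
noncomputable def Fock.vec (S : InvRMatrix E) (l : List E) : Fock S :=
  lp.single 2 l.length ⟨(Real.sqrt l.length.factorial : ℂ) •
    (symProj S l.length).completion (HilbTensor.tprod l.get), by
      exact Submodule.smul_mem _ _ (LinearMap.mem_range_self (symProj S l.length).completion.toLinearMap _)⟩
namespace InvRMatrix

variable (E) in
/-- The tensor flip `x ⊗ y ↦ y ⊗ x`. -/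
noncomputable def flip : InvRMatrix E where
  op := TensorProduct.commIsometry ℂ E E
  invol x := by simp
  ybe x := by
    induction x using TensorProduct.induction_on with
    | zero => simp only [map_zero]
    | add a b ha hb => simp only [map_add, ha, hb]
    | tmul w z =>
      induction w using TensorProduct.induction_on with
      | zero => simp only [TensorProduct.zero_tmul, map_zero]
      | add a b ha hb => simp only [TensorProduct.add_tmul, map_add, ha, hb]
      | tmul x y => simp [left3_tmul, right3_tmul]

variable (E) in
/-- The operator `± 1`. -/
noncomputable def signOp (ε : ℤˣ) : (E ⊗[ℂ] E) ≃ₗᵢ[ℂ] (E ⊗[ℂ] E) where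
  toLinearEquiv := LinearEquiv.ofInvolutive (((ε : ℤ) : ℂ) • LinearMap.id) (fun x => by
    rcases Int.units_eq_one_or ε with rfl | rfl <;> simp)
  norm_map' x := by rcases Int.units_eq_one_or ε with rfl | rfl <;> simp

theorem signOp_apply (ε : ℤˣ) (x : E ⊗[ℂ] E) : signOp E ε x = ((ε : ℤ) : ℂ) • x := rfl

variable (E) in
/-- The involutive R-matrix `ε 1`, for a sign `ε`. -/
noncomputable def sign (ε : ℤˣ) : InvRMatrix E where
  op := signOp E ε
  invol x := by
    rcases Int.units_eq_one_or ε with rfl | rfl <;> simp [signOp_apply]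
  ybe x := by
    have hl : ∀ x, left3 (signOp E ε) x = ((ε : ℤ) : ℂ) • x := by
      intro x
      induction x using TensorProduct.induction_on with
      | zero => simp only [map_zero, smul_zero]
      | add a b ha hb => simp only [map_add, smul_add, ha, hb]
      | tmul w z => rw [left3_tmul, signOp_apply, TensorProduct.smul_tmul']
    have hr : ∀ x, right3 (signOp E ε) x = ((ε : ℤ) : ℂ) • x := by
      intro x
      obtain ⟨x, rfl⟩ := (TensorProduct.assoc ℂ E E E).symm.surjective x
      induction x using TensorProduct.induction_on with
      | zero => simp only [map_zero, smul_zero]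
      | add a b ha hb => simp only [map_add, smul_add, ha, hb]
      | tmul w z =>
        rw [right3_assoc_symm, signOp_apply, TensorProduct.tmul_smul, map_smul]
    simp only [hl, hr]

end InvRMatrix

section boxProd
variable {H : Type u} {K : Type v} [NormedAddCommGroup H] [InnerProductSpace ℂ H]
  [NormedAddCommGroup K] [InnerProductSpace ℂ K]

variable (H K) in
/-- The exchange of the second and third tensor factors. -/
noncomputable def middleSwap :
    ((H ⊗[ℂ] K) ⊗[ℂ] (H ⊗[ℂ] K)) ≃ₗᵢ[ℂ] ((H ⊗[ℂ] H) ⊗[ℂ] (K ⊗[ℂ] K)) :=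
  (TensorProduct.tensorTensorTensorComm ℂ H K H K).isometryOfInner (by
    intro x y
    induction x using TensorProduct.induction_on with
    | zero => simp only [map_zero, inner_zero_left]
    | add a b ha hb => simp only [map_add, inner_add_left, ha, hb]
    | tmul p q =>
    induction y using TensorProduct.induction_on with
    | zero => simp only [map_zero, inner_zero_right]
    | add a b ha hb => simp only [map_add, inner_add_right, ha, hb]
    | tmul r s =>
    induction p using TensorProduct.induction_on with
    | zero => simp only [TensorProduct.zero_tmul, map_zero, inner_zero_left]
    | add a b ha hb => simp only [TensorProduct.add_tmul, map_add, inner_add_left, ha, hb]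
    | tmul p p' =>
    induction q using TensorProduct.induction_on with
    | zero => simp only [TensorProduct.tmul_zero, map_zero, inner_zero_left]
    | add a b ha hb => simp only [TensorProduct.tmul_add, map_add, inner_add_left, ha, hb]
    | tmul q q' =>
    induction r using TensorProduct.induction_on with
    | zero => simp only [TensorProduct.zero_tmul, map_zero, inner_zero_right]
    | add a b ha hb => simp only [TensorProduct.add_tmul, map_add, inner_add_right, ha, hb]
    | tmul r r' =>
    induction s using TensorProduct.induction_on with
    | zero => simp only [TensorProduct.tmul_zero, map_zero, inner_zero_right]
    | add a b ha hb => simp only [TensorProduct.tmul_add, map_add, inner_add_right, ha, hb]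
    | tmul s s' =>
      simp only [TensorProduct.tensorTensorTensorComm_tmul, TensorProduct.inner_tmul]
      ring)

/-- The operator `F₂ (S ⊗ R) F₂`, where `F₂` exchanges the second and third tensor factors. -/
noncomputable def boxProdOp (S : (H ⊗[ℂ] H) ≃ₗᵢ[ℂ] (H ⊗[ℂ] H)) (R : (K ⊗[ℂ] K) ≃ₗᵢ[ℂ] (K ⊗[ℂ] K)) :
    ((H ⊗[ℂ] K) ⊗[ℂ] (H ⊗[ℂ] K)) ≃ₗᵢ[ℂ] ((H ⊗[ℂ] K) ⊗[ℂ] (H ⊗[ℂ] K)) :=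
  ((middleSwap H K).trans (TensorProduct.congrIsometry S R)).trans (middleSwap H K).symm

theorem boxProdOp_symm (S : (H ⊗[ℂ] H) ≃ₗᵢ[ℂ] (H ⊗[ℂ] H)) (R : (K ⊗[ℂ] K) ≃ₗᵢ[ℂ] (K ⊗[ℂ] K))
    (w : H ⊗[ℂ] H) (v : K ⊗[ℂ] K) :
    boxProdOp S R ((middleSwap H K).symm (w ⊗ₜ v)) = (middleSwap H K).symm (S w ⊗ₜ R v) := by
  simp only [boxProdOp, LinearIsometryEquiv.trans_apply, LinearIsometryEquiv.apply_symm_apply]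
  rfl

theorem boxProd_ybe (S : InvRMatrix H) (R : InvRMatrix K)
    (x : ((H ⊗[ℂ] K) ⊗[ℂ] (H ⊗[ℂ] K)) ⊗[ℂ] (H ⊗[ℂ] K)) :
    left3 (boxProdOp S.op R.op) (right3 (boxProdOp S.op R.op) (left3 (boxProdOp S.op R.op) x)) =
      right3 (boxProdOp S.op R.op)
        (left3 (boxProdOp S.op R.op) (right3 (boxProdOp S.op R.op) x)) := by
  let g : (((H ⊗[ℂ] H) ⊗[ℂ] H) ⊗[ℂ] ((K ⊗[ℂ] K) ⊗[ℂ] K)) ≃ₗ[ℂ]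
      (((H ⊗[ℂ] K) ⊗[ℂ] (H ⊗[ℂ] K)) ⊗[ℂ] (H ⊗[ℂ] K)) :=
    (TensorProduct.tensorTensorTensorComm ℂ (H ⊗[ℂ] H) H (K ⊗[ℂ] K) K).trans
      ((middleSwap H K).symm.toLinearEquiv.rTensor (H ⊗[ℂ] K))
  have h1 : ∀ a b, left3 (boxProdOp S.op R.op) (g (a ⊗ₜ b)) =
      g (left3 S.op a ⊗ₜ left3 R.op b) := by
    intro a b
    induction a using TensorProduct.induction_on with
    | zero => simp only [TensorProduct.zero_tmul, map_zero]
    | add a b ha hb => simp only [TensorProduct.add_tmul, map_add, ha, hb]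
    | tmul w z =>
    induction b using TensorProduct.induction_on with
    | zero => simp only [TensorProduct.tmul_zero, map_zero]
    | add a b ha hb => simp only [TensorProduct.tmul_add, map_add, ha, hb]
    | tmul w' z' =>
      change left3 (boxProdOp S.op R.op) ((middleSwap H K).symm (w ⊗ₜ w') ⊗ₜ (z ⊗ₜ z')) =
        (middleSwap H K).symm (S.op w ⊗ₜ R.op w') ⊗ₜ (z ⊗ₜ z')
      rw [left3_tmul, boxProdOp_symm]
  have hg : ∀ (x : H) (x' : K) (w : H ⊗[ℂ] H) (w' : K ⊗[ℂ] K),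
      g ((TensorProduct.assoc ℂ H H H).symm (x ⊗ₜ w) ⊗ₜ
        (TensorProduct.assoc ℂ K K K).symm (x' ⊗ₜ w')) =
      (TensorProduct.assoc ℂ (H ⊗[ℂ] K) (H ⊗[ℂ] K) (H ⊗[ℂ] K)).symm
        ((x ⊗ₜ x') ⊗ₜ (middleSwap H K).symm (w ⊗ₜ w')) := by
    intro x x' w w'
    induction w using TensorProduct.induction_on with
    | zero => simp only [TensorProduct.zero_tmul, TensorProduct.tmul_zero, map_zero]
    | add a b ha hb => simp only [TensorProduct.add_tmul, TensorProduct.tmul_add, map_add, ha, hb]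
    | tmul y z =>
    induction w' using TensorProduct.induction_on with
    | zero => simp only [TensorProduct.tmul_zero, map_zero]
    | add a b ha hb => simp only [TensorProduct.tmul_add, map_add, ha, hb]
    | tmul y' z' => rfl
  have h2 : ∀ a b, right3 (boxProdOp S.op R.op) (g (a ⊗ₜ b)) =
      g (right3 S.op a ⊗ₜ right3 R.op b) := by
    intro a b
    obtain ⟨a, rfl⟩ := (TensorProduct.assoc ℂ H H H).symm.surjective a
    obtain ⟨b, rfl⟩ := (TensorProduct.assoc ℂ K K K).symm.surjective b
    induction a using TensorProduct.induction_on with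
    | zero => simp only [TensorProduct.zero_tmul, map_zero]
    | add a b ha hb => simp only [TensorProduct.add_tmul, map_add, ha, hb]
    | tmul x w =>
    induction b using TensorProduct.induction_on with
    | zero => simp only [TensorProduct.tmul_zero, map_zero]
    | add a b ha hb => simp only [TensorProduct.tmul_add, map_add, ha, hb]
    | tmul x' w' =>
      rw [right3_assoc_symm, right3_assoc_symm, hg, hg, right3_assoc_symm, boxProdOp_symm]
  obtain ⟨y, rfl⟩ := g.surjective x
  induction y using TensorProduct.induction_on with
  | zero => simp only [map_zero]
  | add a b ha hb => simp only [map_add, ha, hb]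
  | tmul a b => simp only [h1, h2, S.ybe, R.ybe]

/-- The box-product of two involutive R-matrices. -/
noncomputable def InvRMatrix.boxProd (S : InvRMatrix H) (R : InvRMatrix K) :
    InvRMatrix (H ⊗[ℂ] K) where
  op := boxProdOp S.op R.op
  invol x := by
    obtain ⟨x, rfl⟩ := (middleSwap H K).symm.surjective x
    induction x using TensorProduct.induction_on with
    | zero => simp only [map_zero]
    | add a b ha hb => simp only [map_add, ha, hb]
    | tmul a b => simp only [boxProdOp_symm, S.invol, R.invol]
  ybe := boxProd_ybe S R
/-- The box-product of `S` with the tensor flip of `L`. -/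
noncomputable def InvRMatrix.tilde (S : InvRMatrix H) (L : Type v) [NormedAddCommGroup L]
    [InnerProductSpace ℂ L] : InvRMatrix (H ⊗[ℂ] L) :=
  S.boxProd (InvRMatrix.flip L)

end boxProd

section boxSum
variable {ι : Type} [Fintype ι] [DecidableEq ι] {H : ι → Type u}
  [∀ i, NormedAddCommGroup (H i)] [∀ i, InnerProductSpace ℂ (H i)]

variable (H) in
/-- The inclusion of the summand `H i` into the orthogonal direct sum. -/
noncomputable def incl (i : ι) : H i →ₗᵢ[ℂ] PiLp 2 H where
  toFun := PiLp.single 2 i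
  map_add' x y := PiLp.single_add 2 i
  map_smul' c x := by
    ext j
    rcases eq_or_ne j i with rfl | h
    · simp
    · simp [h]
  norm_map' x := PiLp.norm_single 2 H i x

/-- The operator on the tensor square of `⨁ i, H i` that acts as `S i` on each `H i ⊗ H i` and as the
flip `H i ⊗ H j → H j ⊗ H i` for `i ≠ j`. -/
noncomputable def boxSumMap (S : ∀ i, (H i ⊗[ℂ] H i) →ₗ[ℂ] (H i ⊗[ℂ] H i)) :
    (PiLp 2 H ⊗[ℂ] PiLp 2 H) →ₗ[ℂ] (PiLp 2 H ⊗[ℂ] PiLp 2 H) :=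
  ∑ i, ∑ j, if i = j then
      TensorProduct.map (incl H i).toLinearMap (incl H i).toLinearMap ∘ₗ S i ∘ₗ
        TensorProduct.map (PiLp.projₗ 2 H i) (PiLp.projₗ 2 H i)
    else
      (TensorProduct.comm ℂ (PiLp 2 H) (PiLp 2 H)).toLinearMap ∘ₗ
        TensorProduct.map ((incl H i).toLinearMap ∘ₗ PiLp.projₗ 2 H i)
          ((incl H j).toLinearMap ∘ₗ PiLp.projₗ 2 H j)

theorem proj_incl_same (i : ι) (x : H i) :
    (PiLp.projₗ 2 H i : PiLp 2 H →ₗ[ℂ] H i) (incl H i x) = x :=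
  PiLp.single_eq_same 2 i x

theorem proj_incl_ne {i j : ι} (h : i ≠ j) (x : H i) :
    (PiLp.projₗ 2 H j : PiLp 2 H →ₗ[ℂ] H j) (incl H i x) = 0 :=
  PiLp.single_eq_of_ne 2 h.symm x

theorem sum_incl (x : PiLp 2 H) : ∑ i, incl H i (x i) = x := by
  ext j
  rw [WithLp.ofLp_sum, Finset.sum_apply, Finset.sum_eq_single j]
  · exact PiLp.single_eq_same 2 j (x j)
  · intro i _ h
    exact PiLp.single_eq_of_ne 2 h.symm (x i)
  · simp

theorem inner_incl_same (i : ι) (x y : H i) : inner ℂ (incl H i x) (incl H i y) = inner ℂ x y :=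
  (incl H i).inner_map_map x y

theorem inner_incl_ne {i j : ι} (h : i ≠ j) (x : H i) (y : H j) :
    inner ℂ (incl H i x) (incl H j y) = 0 := by
  rw [PiLp.inner_apply]
  refine Finset.sum_eq_zero fun k _ => ?_
  rcases eq_or_ne k i with rfl | hk
  · have : (incl H j y) k = 0 := PiLp.single_eq_of_ne 2 h y
    rw [this, inner_zero_right]
  · have : (incl H i x) k = 0 := PiLp.single_eq_of_ne 2 hk x
    rw [this, inner_zero_left]

variable (H) in
/-- The inclusion `H i ⊗ H i → (⊕ H) ⊗ (⊕ H)`. -/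
noncomputable def incl₂ (i : ι) : (H i ⊗[ℂ] H i) →ₗᵢ[ℂ] (PiLp 2 H ⊗[ℂ] PiLp 2 H) :=
  TensorProduct.mapIsometry (incl H i) (incl H i)

theorem incl₂_tmul (i : ι) (x y : H i) : incl₂ H i (x ⊗ₜ y) = incl H i x ⊗ₜ incl H i y := rfl

theorem boxSumMap_incl₂ (S : ∀ i, (H i ⊗[ℂ] H i) →ₗ[ℂ] (H i ⊗[ℂ] H i)) (i : ι)
    (w : H i ⊗[ℂ] H i) : boxSumMap S (incl₂ H i w) = incl₂ H i (S i w) := by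
  induction w using TensorProduct.induction_on with
  | zero => simp only [map_zero]
  | add a b ha hb => simp only [map_add, ha, hb]
  | tmul x y =>
    rw [incl₂_tmul, boxSumMap, LinearMap.sum_apply, Finset.sum_eq_single i]
    · rw [LinearMap.sum_apply, Finset.sum_eq_single i]
      · simp only [if_true, LinearMap.comp_apply, TensorProduct.map_tmul, proj_incl_same]
        rfl
      · intro k _ hk
        rw [if_neg hk.symm]
        simp only [LinearMap.comp_apply, TensorProduct.map_tmul, proj_incl_ne hk.symm, map_zero,
          TensorProduct.tmul_zero]
      · simp
    · intro j _ hj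
      rw [LinearMap.sum_apply]
      refine Finset.sum_eq_zero fun k _ => ?_
      split_ifs <;>
      simp only [LinearMap.comp_apply, TensorProduct.map_tmul, proj_incl_ne hj.symm, map_zero,
        TensorProduct.zero_tmul]
    · simp

theorem boxSumMap_ne (S : ∀ i, (H i ⊗[ℂ] H i) →ₗ[ℂ] (H i ⊗[ℂ] H i)) {i j : ι} (h : i ≠ j)
    (x : H i) (y : H j) : boxSumMap S (incl H i x ⊗ₜ incl H j y) = incl H j y ⊗ₜ incl H i x := by
  rw [boxSumMap, LinearMap.sum_apply, Finset.sum_eq_single i]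
  · rw [LinearMap.sum_apply, Finset.sum_eq_single j]
    · rw [if_neg h]
      simp only [LinearMap.comp_apply, TensorProduct.map_tmul]
      erw [proj_incl_same, proj_incl_same]
      rfl
    · intro k _ hk
      split_ifs with hik
      · subst hik
        simp only [LinearMap.comp_apply, TensorProduct.map_tmul, proj_incl_ne hk.symm, map_zero,
          TensorProduct.tmul_zero]
      · simp only [LinearMap.comp_apply, TensorProduct.map_tmul, proj_incl_ne hk.symm, map_zero,
          TensorProduct.tmul_zero]
    · simp
  · intro k _ hk
    rw [LinearMap.sum_apply]
    refine Finset.sum_eq_zero fun l _ => ?_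
    split_ifs <;>
    simp only [LinearMap.comp_apply, TensorProduct.map_tmul, proj_incl_ne hk.symm, map_zero,
        TensorProduct.zero_tmul]
  · simp

theorem sum_induction {P : PiLp 2 H ⊗[ℂ] PiLp 2 H → Prop} (h0 : P 0)
    (hadd : ∀ x y, P x → P y → P (x + y)) (h1 : ∀ i w, P (incl₂ H i w))
    (h2 : ∀ i j, i ≠ j → ∀ x y, P (incl H i x ⊗ₜ incl H j y)) (x : PiLp 2 H ⊗[ℂ] PiLp 2 H) :
    P x := by
  have hsum : ∀ {κ : Type} (s : Finset κ) (f : κ → PiLp 2 H ⊗[ℂ] PiLp 2 H),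
      (∀ i, P (f i)) → P (∑ i ∈ s, f i) := fun s f hf =>
    Finset.sum_induction f P hadd h0 fun i _ => hf i
  induction x using TensorProduct.induction_on with
  | zero => exact h0
  | add a b ha hb => exact hadd a b ha hb
  | tmul x y =>
    rw [← sum_incl x, ← sum_incl y, TensorProduct.sum_tmul]
    refine hsum _ _ fun i => ?_
    rw [TensorProduct.tmul_sum]
    refine hsum _ _ fun j => ?_
    rcases eq_or_ne i j with rfl | h
    · exact h1 i (x i ⊗ₜ y i)
    · exact h2 i j h _ _

theorem inner_incl₂_ne {i j : ι} (h : i ≠ j) (w : H i ⊗[ℂ] H i) (v : H j ⊗[ℂ] H j) :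
    inner ℂ (incl₂ H i w) (incl₂ H j v) = 0 := by
  induction w using TensorProduct.induction_on with
  | zero => simp only [map_zero, inner_zero_left]
  | add a b ha hb => simp only [map_add, inner_add_left, ha, hb, add_zero]
  | tmul x y =>
  induction v using TensorProduct.induction_on with
  | zero => simp only [map_zero, inner_zero_right]
  | add a b ha hb => simp only [map_add, inner_add_right, ha, hb, add_zero]
  | tmul x' y' =>
    rw [incl₂_tmul, incl₂_tmul, TensorProduct.inner_tmul, inner_incl_ne h, zero_mul]

theorem inner_incl₂_tmul {i j k : ι} (h : j ≠ k) (w : H i ⊗[ℂ] H i) (x : H j) (y : H k) :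
    inner ℂ (incl₂ H i w) (incl H j x ⊗ₜ[ℂ] incl H k y) = 0 := by
  induction w using TensorProduct.induction_on with
  | zero => simp only [map_zero, inner_zero_left]
  | add a b ha hb => simp only [map_add, inner_add_left, ha, hb, add_zero]
  | tmul x' y' =>
    rw [incl₂_tmul, TensorProduct.inner_tmul]
    rcases eq_or_ne i j with rfl | hij
    · rw [inner_incl_ne h, mul_zero]
    · rw [inner_incl_ne hij, zero_mul]

theorem boxSumMap_inner (S : ∀ i, (H i ⊗[ℂ] H i) ≃ₗᵢ[ℂ] (H i ⊗[ℂ] H i))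
    (u v : PiLp 2 H ⊗[ℂ] PiLp 2 H) :
    inner ℂ (boxSumMap (fun i => (S i).toLinearEquiv.toLinearMap) u)
      (boxSumMap (fun i => (S i).toLinearEquiv.toLinearMap) v) = inner ℂ u v := by
  set B := boxSumMap (fun i => (S i).toLinearEquiv.toLinearMap) with hB
  have hB1 : ∀ i w, B (incl₂ H i w) = incl₂ H i (S i w) := fun i w => boxSumMap_incl₂ _ i w
  have hB2 : ∀ i j, i ≠ j → ∀ x y, B (incl H i x ⊗ₜ incl H j y) = incl H j y ⊗ₜ incl H i x :=
    fun i j h x y => boxSumMap_ne _ h x y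
  induction u using sum_induction with
  | h0 => simp only [map_zero, inner_zero_left]
  | hadd a b ha hb => simp only [map_add, inner_add_left, ha, hb]
  | h1 i w =>
    induction v using sum_induction with
    | h0 => simp only [map_zero, inner_zero_right]
    | hadd a b ha hb => simp only [map_add, inner_add_right, ha, hb]
    | h1 j v =>
      rw [hB1, hB1]
      rcases eq_or_ne i j with rfl | h
      · rw [LinearIsometry.inner_map_map, LinearIsometry.inner_map_map,
          LinearIsometryEquiv.inner_map_map]
      · rw [inner_incl₂_ne h, inner_incl₂_ne h]
    | h2 j k h x y => rw [hB1, hB2 j k h, inner_incl₂_tmul h, inner_incl₂_tmul h.symm]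
  | h2 i i' hi x y =>
    induction v using sum_induction with
    | h0 => simp only [map_zero, inner_zero_right]
    | hadd a b ha hb => simp only [map_add, inner_add_right, ha, hb]
    | h1 j v =>
      rw [hB1, hB2 i i' hi, ← inner_conj_symm, inner_incl₂_tmul hi.symm, ← inner_conj_symm,
        inner_incl₂_tmul hi]
    | h2 j k h x y =>
      rw [hB2 i i' hi, hB2 j k h, TensorProduct.inner_tmul, TensorProduct.inner_tmul, mul_comm]

theorem boxSumMap_invol (S : ∀ i, InvRMatrix (H i)) (u : PiLp 2 H ⊗[ℂ] PiLp 2 H) :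
    boxSumMap (fun i => (S i).op.toLinearEquiv.toLinearMap)
      (boxSumMap (fun i => (S i).op.toLinearEquiv.toLinearMap) u) = u := by
  induction u using sum_induction with
  | h0 => simp only [map_zero]
  | hadd a b ha hb => simp only [map_add, ha, hb]
  | h1 i w =>
    rw [boxSumMap_incl₂, boxSumMap_incl₂]
    exact congrArg _ ((S i).invol w)
  | h2 i j h x y => rw [boxSumMap_ne _ h, boxSumMap_ne _ h.symm]

/-- The operator `boxSumMap`, as a unitary. -/
noncomputable def boxSumOp (S : ∀ i, InvRMatrix (H i)) :
    (PiLp 2 H ⊗[ℂ] PiLp 2 H) ≃ₗᵢ[ℂ] (PiLp 2 H ⊗[ℂ] PiLp 2 H) :=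
  (LinearEquiv.ofInvolutive (boxSumMap fun i => (S i).op.toLinearEquiv.toLinearMap)
    (boxSumMap_invol S)).isometryOfInner (boxSumMap_inner fun i => (S i).op)

theorem boxSumOp_incl₂ (S : ∀ i, InvRMatrix (H i)) (i : ι) (w : H i ⊗[ℂ] H i) :
    boxSumOp S (incl₂ H i w) = incl₂ H i ((S i).op w) :=
  boxSumMap_incl₂ _ i w

theorem boxSumOp_ne (S : ∀ i, InvRMatrix (H i)) {i j : ι} (h : i ≠ j) (x : H i) (y : H j) :
    boxSumOp S (incl H i x ⊗ₜ incl H j y) = incl H j y ⊗ₜ incl H i x :=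
  boxSumMap_ne _ h x y

set_option maxHeartbeats 1000000 in
theorem boxSum_ybe (S : ∀ i, InvRMatrix (H i))
    (t : (PiLp 2 H ⊗[ℂ] PiLp 2 H) ⊗[ℂ] PiLp 2 H) :
    left3 (boxSumOp S) (right3 (boxSumOp S) (left3 (boxSumOp S) t)) =
      right3 (boxSumOp S) (left3 (boxSumOp S) (right3 (boxSumOp S) t)) := by
  let α := (TensorProduct.assoc ℂ (PiLp 2 H) (PiLp 2 H) (PiLp 2 H)).symm
  have hα : ∀ a b c, α (a ⊗ₜ (b ⊗ₜ c)) = (a ⊗ₜ b) ⊗ₜ c := fun _ _ _ => rfl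
  have hr : ∀ a b c, right3 (boxSumOp S) ((a ⊗ₜ b) ⊗ₜ c) = α (a ⊗ₜ boxSumOp S (b ⊗ₜ c)) :=
    fun a b c => right3_tmul _ a b c
  have hr' : ∀ a w, right3 (boxSumOp S) (α (a ⊗ₜ w)) = α (a ⊗ₜ boxSumOp S w) :=
    fun a w => right3_assoc_symm _ a w
  -- moving a vector of a different summand past a pair
  have L1 : ∀ i l, i ≠ l → ∀ (w : H i ⊗[ℂ] H i) (z : H l),
      left3 (boxSumOp S) (right3 (boxSumOp S) (incl₂ H i w ⊗ₜ incl H l z)) =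
        α (incl H l z ⊗ₜ incl₂ H i w) := by
    intro i l h w z
    induction w using TensorProduct.induction_on with
    | zero => simp only [map_zero, TensorProduct.zero_tmul, TensorProduct.tmul_zero]
    | add a b ha hb => simp only [map_add, TensorProduct.add_tmul, TensorProduct.tmul_add, ha, hb]
    | tmul x y =>
      rw [incl₂_tmul, hr, boxSumOp_ne S h, hα, left3_tmul, boxSumOp_ne S h, hα]
  have L2 : ∀ i l, i ≠ l → ∀ (w : H i ⊗[ℂ] H i) (z : H l),
      right3 (boxSumOp S) (left3 (boxSumOp S) (α (incl H l z ⊗ₜ incl₂ H i w))) =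
        incl₂ H i w ⊗ₜ incl H l z := by
    intro i l h w z
    induction w using TensorProduct.induction_on with
    | zero => simp only [map_zero, TensorProduct.zero_tmul, TensorProduct.tmul_zero]
    | add a b ha hb => simp only [map_add, TensorProduct.add_tmul, TensorProduct.tmul_add, ha, hb]
    | tmul x y =>
      rw [incl₂_tmul, hα, left3_tmul, boxSumOp_ne S h.symm, hr, boxSumOp_ne S h.symm, hα]
  have L3 : ∀ i l, i ≠ l → ∀ (w : H i ⊗[ℂ] H i) (z : H l),
      left3 (boxSumOp S) (α (incl H l z ⊗ₜ incl₂ H i w)) =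
        right3 (boxSumOp S) (incl₂ H i w ⊗ₜ incl H l z) := by
    intro i l h w z
    induction w using TensorProduct.induction_on with
    | zero => simp only [map_zero, TensorProduct.zero_tmul, TensorProduct.tmul_zero]
    | add a b ha hb => simp only [map_add, TensorProduct.add_tmul, TensorProduct.tmul_add, ha, hb]
    | tmul x y =>
      rw [incl₂_tmul, hα, left3_tmul, boxSumOp_ne S h.symm, hr, boxSumOp_ne S h, hα]
  have M1 : ∀ i (s : (H i ⊗[ℂ] H i) ⊗[ℂ] H i),
      left3 (boxSumOp S) (TensorProduct.map (incl₂ H i).toLinearMap (incl H i).toLinearMap s) =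
        TensorProduct.map (incl₂ H i).toLinearMap (incl H i).toLinearMap (left3 (S i).op s) := by
    intro i s
    induction s using TensorProduct.induction_on with
    | zero => simp only [map_zero]
    | add a b ha hb => simp only [map_add, ha, hb]
    | tmul w z =>
      rw [left3_tmul, TensorProduct.map_tmul, TensorProduct.map_tmul, left3_tmul]
      exact congrArg (fun x => x ⊗ₜ[ℂ] incl H i z) (boxSumOp_incl₂ S i w)
  have M2 : ∀ i (s : (H i ⊗[ℂ] H i) ⊗[ℂ] H i),
      right3 (boxSumOp S) (TensorProduct.map (incl₂ H i).toLinearMap (incl H i).toLinearMap s) =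
        TensorProduct.map (incl₂ H i).toLinearMap (incl H i).toLinearMap (right3 (S i).op s) := by
    intro i s
    have hm : ∀ (z : H i) (w : H i ⊗[ℂ] H i),
        TensorProduct.map (incl₂ H i).toLinearMap (incl H i).toLinearMap
          ((TensorProduct.assoc ℂ (H i) (H i) (H i)).symm (z ⊗ₜ w)) =
        α (incl H i z ⊗ₜ incl₂ H i w) := by
      intro z w
      induction w using TensorProduct.induction_on with
      | zero => simp only [map_zero, TensorProduct.tmul_zero]
      | add a b ha hb => simp only [map_add, TensorProduct.tmul_add, ha, hb]
      | tmul x y => rfl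
    obtain ⟨s, rfl⟩ := (TensorProduct.assoc ℂ (H i) (H i) (H i)).symm.surjective s
    induction s using TensorProduct.induction_on with
    | zero => simp only [map_zero]
    | add a b ha hb => simp only [map_add, ha, hb]
    | tmul z w => rw [right3_assoc_symm, hm, hm, hr', boxSumOp_incl₂]
  have hsum : ∀ (κ : Type) (s : Finset κ) (f : κ → (PiLp 2 H ⊗[ℂ] PiLp 2 H) ⊗[ℂ] PiLp 2 H),
      (∀ i, left3 (boxSumOp S) (right3 (boxSumOp S) (left3 (boxSumOp S) (f i))) =
        right3 (boxSumOp S) (left3 (boxSumOp S) (right3 (boxSumOp S) (f i)))) →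
      left3 (boxSumOp S) (right3 (boxSumOp S) (left3 (boxSumOp S) (∑ i ∈ s, f i))) =
        right3 (boxSumOp S) (left3 (boxSumOp S) (right3 (boxSumOp S) (∑ i ∈ s, f i))) := by
    intro κ s f hf
    simp only [map_sum, hf]
  induction t using TensorProduct.induction_on with
  | zero => simp only [map_zero]
  | add a b ha hb => simp only [map_add, ha, hb]
  | tmul p c =>
  rw [← sum_incl c, TensorProduct.tmul_sum]
  refine hsum _ _ _ fun l => ?_
  generalize c l = z
  induction p using sum_induction with
  | h0 => simp only [TensorProduct.zero_tmul, map_zero]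
  | hadd a b ha hb => simp only [TensorProduct.add_tmul, map_add, ha, hb]
  | h1 i w =>
    rcases eq_or_ne i l with rfl | h
    · have h : incl₂ H i w ⊗ₜ[ℂ] incl H i z =
        TensorProduct.map (incl₂ H i).toLinearMap (incl H i).toLinearMap (w ⊗ₜ z) := rfl
      simp only [h, M1, M2, (S i).ybe]
    · rw [left3_tmul, boxSumOp_incl₂, L1 i l h, L1 i l h, hr', boxSumOp_incl₂]
  | h2 i k hik x y =>
    rcases eq_or_ne k l with rfl | hkl
    · have h : (incl H i x ⊗ₜ[ℂ] incl H k y) ⊗ₜ[ℂ] incl H k z =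
        α (incl H i x ⊗ₜ incl₂ H k (y ⊗ₜ z)) := rfl
      rw [h, L2 k i hik.symm, left3_tmul, boxSumOp_incl₂, hr', boxSumOp_incl₂, L2 k i hik.symm]
    · rcases eq_or_ne i l with rfl | hil
      · rw [left3_tmul, boxSumOp_ne S hik, hr, ← incl₂_tmul, boxSumOp_incl₂, L3 i k hik,
          hr, boxSumOp_ne S hkl, hα, left3_tmul, ← incl₂_tmul, boxSumOp_incl₂]
      · rw [left3_tmul, boxSumOp_ne S hik, hr, boxSumOp_ne S hil, hα, left3_tmul,
          boxSumOp_ne S hkl, hr, boxSumOp_ne S hkl, hα, left3_tmul, boxSumOp_ne S hil, hr,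
          boxSumOp_ne S hik, hα]

/-- The box-sum of finitely many involutive R-matrices; for two summands it is `S ⊕ R ⊕ F` on
`(H ⊗ H) ⊕ (K ⊗ K) ⊕ ((H ⊗ K) ⊕ (K ⊗ H))`, and in general it is the iterated binary box-sum. -/
noncomputable def InvRMatrix.boxSum (S : ∀ i, InvRMatrix (H i)) : InvRMatrix (PiLp 2 H) where
  op := boxSumOp S
  invol := boxSumMap_invol S
  ybe := boxSum_ybe S
end boxSum
end
end RFock

/-! Two total families in Hilbert spaces, indexed by the same set and with the same Gram matrix, are
related by a unitary (`exists_unitary_of_inner_eq`). Here the indices are finite lists of pairs (x,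
k) with x in one of the summands `H i` and k in `L`. One family consists of the Fock vectors of
these lists, the other of the tensor products over i of the Fock vectors of the sublists with index
i. Thus the theorem amounts to the factorisation of ⟨[g], [l]⟩ over the summands, together with
totality.

The normalisation √(n!) turns ⟨[g], [l]⟩ into the sum over all permutations π of ⟨g₁ ⊗ ⋯ ⊗ gₙ,
D(π)(l₁ ⊗ ⋯ ⊗ lₙ)⟩. Every π of n + 1 letters is uniquely a permutation of the last n letters after a
cycle that moves some k to the front (`moveFront_bijective`). On the vectors x ⊗ k the R-matrix
sends elementary tensors to multiples of elementary tensors, a rule recorded by `exch`. So the sum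
obeys a recursion similar to the Laplace expansion of a determinant or permanent: g₁ is paired with
each entry of l that has been moved to the front (`sum_moveFront_listTensor`, `sum_inner_permRep`).
The recursion defines `fockKernel`, which depends only on the one-particle inner products and on
`exch`.

The factorisation is then combinatorics. Vectors of different summands are orthogonal, so g₁ only
meets entries of its own index, and on its way to the front such an entry passes entries of other
indices by the plain flip, without coefficient or change. Hence each step of the recursion affects
one sublist only (`sum_moves_sigma`, `fockKernel_sigma`).

Totality holds because elementary tensors of total families are total (`HilbTensor.total`,
`total_vec`). Both sides of the intertwining relation are additive in each entry of the list, which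
extends it from x ⊗ k to arbitrary vectors of `H i ⊗ L`. -/

namespace RFock

/-! ### A recursion for the inner products of Fock vectors. -/

section kernel
variable {X : Type*}

/-- The terms of `∑ k, S₁ ⋯ Sₖ` on an elementary tensor, each as a coefficient, the first factor
and the list of the other factors. Here `exch f h = (a, h', f')` encodes `S (f ⊗ h) = a • h' ⊗ f'`. -/
def moves (exch : X → X → ℂ × X × X) : List X → List (ℂ × X × List X)
  | [] => []
  | f :: l => (1, f, l) :: (moves exch l).map fun m =>
      (m.1 * (exch f m.2.1).1, (exch f m.2.1).2.1, (exch f m.2.1).2.2 :: m.2.2)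

theorem length_of_mem_moves (exch : X → X → ℂ × X × X) :
    ∀ {l : List X} {m : ℂ × X × List X}, m ∈ moves exch l → m.2.2.length + 1 = l.length
  | [], _, h => by simp [moves] at h
  | f :: l, m, h => by
    rw [moves, List.mem_cons, List.mem_map] at h
    rcases h with rfl | ⟨m, hm, rfl⟩
    · rfl
    · simpa using length_of_mem_moves exch hm

/-- The inner products of the vectors `Fock.vec`, in terms of the inner products `κ` of the
one-particle vectors and of the exchange rule `exch`. -/
noncomputable def fockKernel (κ : X → X → ℂ) (exch : X → X → ℂ × X × X) : List X → List X → ℂ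
  | [], [] => 1
  | [], _ :: _ => 0
  | g :: g', l =>
    ((moves exch l).map fun m => m.1 * (κ g m.2.1 * fockKernel κ exch g' m.2.2)).sum

theorem fockKernel_cons (κ : X → X → ℂ) (exch : X → X → ℂ × X × X) (g : X) (g' l : List X) :
    fockKernel κ exch (g :: g') l =
      ((moves exch l).map fun m => m.1 * (κ g m.2.1 * fockKernel κ exch g' m.2.2)).sum := by
  rw [fockKernel]

theorem fockKernel_of_length_ne (κ : X → X → ℂ) (exch : X → X → ℂ × X × X) :
    ∀ {g l : List X}, g.length ≠ l.length → fockKernel κ exch g l = 0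
  | [], [], h => absurd rfl h
  | [], _ :: _, _ => by rw [fockKernel]
  | g :: g', l, h => by
    rw [fockKernel_cons]
    refine List.sum_eq_zero fun c hc => ?_
    obtain ⟨m, hm, rfl⟩ := List.mem_map.mp hc
    have := length_of_mem_moves exch hm
    rw [fockKernel_of_length_ne κ exch (by simp at h; omega), mul_zero, mul_zero]

end kernel

/-! ### Factorisation of the recursion over the summands. -/

section lookup
variable {ι : Type*} [DecidableEq ι] {X : ι → Type*}

/-- Prepend `p.2` to the list with index `p.1`. -/
def consAt (p : Σ i, X i) (t : ∀ i, List (X i)) : ∀ i, List (X i) :=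
  Function.update t p.1 (p.2 :: t p.1)

theorem consAt_mk (i : ι) (x : X i) (t : ∀ i, List (X i)) :
    consAt ⟨i, x⟩ t = Function.update t i (x :: t i) := rfl

theorem lookupAll_cons (p : Σ i, X i) (l : List (Σ i, X i)) :
    (fun i => (p :: l).lookupAll i) = consAt p fun i => l.lookupAll i := by
  rw [consAt]
  obtain ⟨j, x⟩ := p
  funext i
  rcases eq_or_ne i j with rfl | h
  · simp
  · rw [List.lookupAll_cons_ne _ _ h, Function.update_of_ne h]

theorem lookupAll_append (i : ι) (l l' : List (Σ i, X i)) :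
    (l ++ l').lookupAll i = l.lookupAll i ++ l'.lookupAll i := by
  induction l with
  | nil => simp
  | cons p l ih =>
    obtain ⟨j, x⟩ := p
    rcases eq_or_ne i j with rfl | h
    · simp [ih]
    · rw [List.cons_append, List.lookupAll_cons_ne _ _ h, List.lookupAll_cons_ne _ _ h, ih]

theorem lookupAll_map {Y : ι → Type*} (φ : ∀ i, X i → Y i) (i : ι) (l : List (Σ i, X i)) :
    (l.map fun p => (⟨p.1, φ p.1 p.2⟩ : Σ i, Y i)).lookupAll i = (l.lookupAll i).map (φ i) := by
  induction l with
  | nil => simp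
  | cons p l ih =>
    obtain ⟨j, x⟩ := p
    rcases eq_or_ne i j with rfl | h
    · simp [ih]
    · rw [List.map_cons, List.lookupAll_cons_ne _ _ h, List.lookupAll_cons_ne _ _ h, ih]

/-- Concatenate the lists `L j`, one block for each index. This makes every product of Fock vectors
of the summands the image of a single list, as totality of the target family requires. -/
theorem exists_lookupAll_eq [Fintype ι] (L : ∀ i, List (X i)) :
    ∃ l : List (Σ i, X i), ∀ i, l.lookupAll i = L i := by
  have h1 : ∀ (j i : ι) (m : List (X j)),
      (m.map (Sigma.mk j)).lookupAll i = if h : j = i then h ▸ m else [] := by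
    intro j i m
    induction m with
    | nil => split_ifs with h
             · subst h; simp
             · simp
    | cons x m ih =>
      rcases eq_or_ne i j with rfl | h
      · simpa using ih
      · rw [dif_neg h.symm] at ih ⊢
        rw [List.map_cons, List.lookupAll_cons_ne _ _ h, ih]
  have h2 : ∀ s : Finset ι, ∃ l : List (Σ i, X i),
      ∀ i, l.lookupAll i = if i ∈ s then L i else [] := by
    intro s
    induction s using Finset.induction_on with
    | empty => exact ⟨[], by simp⟩
    | insert j s hj ih =>
      obtain ⟨l, hl⟩ := ih
      refine ⟨(L j).map (Sigma.mk j) ++ l, fun i => ?_⟩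
      rw [lookupAll_append, h1, hl]
      rcases eq_or_ne i j with rfl | h
      · simp [hj]
      · simp [h, h.symm]
  obtain ⟨l, hl⟩ := h2 Finset.univ
  exact ⟨l, fun i => by simpa using hl i⟩

variable {κ : (Σ i, X i) → (Σ i, X i) → ℂ} {exch : (Σ i, X i) → (Σ i, X i) → ℂ × (Σ i, X i) × (Σ i, X i)}
  {κ' : ∀ i, X i → X i → ℂ} {exch' : ∀ i, X i → X i → ℂ × X i × X i}

/-- Since `Φ` vanishes unless the vector in front has index `j`, only moves of entries of index `j`
count. Such an entry passes entries of other indices by the flip with coefficient 1, so it interacts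
with the sublist of index `j` alone. -/
theorem sum_moves_sigma
    (hs : ∀ i f h, exch ⟨i, f⟩ ⟨i, h⟩ =
      ((exch' i f h).1, ⟨i, (exch' i f h).2.1⟩, ⟨i, (exch' i f h).2.2⟩))
    (hd : ∀ i j, i ≠ j → ∀ f h, exch ⟨i, f⟩ ⟨j, h⟩ = (1, ⟨j, h⟩, ⟨i, f⟩)) (j : ι)
    (l : List (Σ i, X i)) : ∀ (Φ : (Σ i, X i) → (∀ i, List (X i)) → ℂ)
      (_ : ∀ i, i ≠ j → ∀ x t, Φ ⟨i, x⟩ t = 0),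
    ((moves exch l).map fun m => m.1 * Φ m.2.1 fun i => m.2.2.lookupAll i).sum =
      ((moves (exch' j) (l.lookupAll j)).map fun m =>
        m.1 * Φ ⟨j, m.2.1⟩ (Function.update (fun i => l.lookupAll i) j m.2.2)).sum := by
  induction l with
  | nil => intro Φ hΦ; simp [moves]
  | cons p l ih =>
    intro Φ hΦ
    -- Moving an entry `q` of the tail to the front ends with its exchange with the head `p`.
    -- Absorbing this last exchange into `Φ` leaves a sum over the moves of the tail; the vanishing
    -- condition survives because `exch` moves the index of `q` to the front.
    have h := ih (fun q t => (exch p q).1 * Φ (exch p q).2.1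
      (consAt (exch p q).2.2 t)) (by
        intro k hk x t
        obtain ⟨i, f⟩ := p
        rcases eq_or_ne i k with rfl | hik
        · simp only [hs, hΦ i hk, mul_zero]
        · simp only [hd i k hik, hΦ k hk, mul_zero])
    simp only [moves, List.map_cons, List.sum_cons, List.map_map, Function.comp_def,
      lookupAll_cons, mul_assoc, one_mul]
    rw [h]
    clear h ih
    obtain ⟨i, f⟩ := p
    -- If the head has index `j`, it gives the first term on both sides. Otherwise its own term is
    -- killed by `Φ` and it is only passed over.
    rcases eq_or_ne j i with rfl | hji
    · simp [hs, moves, Function.comp_def, mul_assoc, consAt_mk]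
    · rw [List.lookupAll_cons_ne l ⟨i, f⟩ hji]
      simp only [hd i j hji.symm, hΦ i hji.symm, zero_add, one_mul, consAt_mk,
        Function.update_of_ne hji.symm, Function.update_comm hji]

theorem fockKernel_sigma [Fintype ι]
    (hs : ∀ i f h, exch ⟨i, f⟩ ⟨i, h⟩ =
      ((exch' i f h).1, ⟨i, (exch' i f h).2.1⟩, ⟨i, (exch' i f h).2.2⟩))
    (hd : ∀ i j, i ≠ j → ∀ f h, exch ⟨i, f⟩ ⟨j, h⟩ = (1, ⟨j, h⟩, ⟨i, f⟩))
    (hκs : ∀ i f h, κ ⟨i, f⟩ ⟨i, h⟩ = κ' i f h)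
    (hκd : ∀ i j, i ≠ j → ∀ f h, κ ⟨i, f⟩ ⟨j, h⟩ = 0) (g : List (Σ i, X i)) :
    ∀ l : List (Σ i, X i), fockKernel κ exch g l =
      ∏ i, fockKernel (κ' i) (exch' i) (g.lookupAll i) (l.lookupAll i) := by
  induction g with
  | nil =>
    intro l
    cases l with
    | nil => simp [fockKernel]
    | cons p l =>
      obtain ⟨j, f⟩ := p
      rw [fockKernel]
      -- The factor at the index of the head compares an empty list with a nonempty one.
      refine (Finset.prod_eq_zero (Finset.mem_univ j) ?_).symm
      rw [List.lookupAll_nil, List.lookupAll_cons_eq, fockKernel]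
  | cons p g ih =>
    intro l
    obtain ⟨j, f⟩ := p
    simp only [fockKernel_cons, ih]
    -- Orthogonality of different summands is the vanishing condition on `Φ`. The factors with index
    -- other than `j` then do not depend on the move and come out of the sum; factor `j` is expanded
    -- by its own recursion.
    rw [sum_moves_sigma hs hd j l (fun q t => κ ⟨j, f⟩ q *
      ∏ i, fockKernel (κ' i) (exch' i) (g.lookupAll i) (t i))
      (fun i hi x t => by rw [hκd j i hi.symm, zero_mul]),
      ← Finset.mul_prod_erase _ _ (Finset.mem_univ j), List.lookupAll_cons_eq, fockKernel_cons,
      ← List.sum_map_mul_right]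
    congr 2
    funext m
    rw [← Finset.mul_prod_erase _ _ (Finset.mem_univ j), Function.update_self, hκs, mul_assoc,
      mul_assoc]
    congr 3
    refine Finset.prod_congr rfl fun i hi => ?_
    rw [Function.update_of_ne (Finset.ne_of_mem_erase hi),
      List.lookupAll_cons_ne _ _ (Finset.ne_of_mem_erase hi)]

end lookup

/-! ### The sum over the symmetric group, by cosets of the permutations that fix the first position.
-/

section tensor
variable {E : Type u} [NormedAddCommGroup E] [InnerProductSpace ℂ E]

/-- The elementary tensor of the first `n` entries of a list. -/
noncomputable def listTensor : (n : ℕ) → List E → TPow E n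
  | 0, _ => AlgTensor.tprod (E := fun _ : Fin 0 => E) (fun i => i.elim0)
  | _ + 1, [] => 0
  | n + 1, f :: l => TPow.succIso E n (f ⊗ₜ listTensor n l)

theorem listTensor_cons (n : ℕ) (f : E) (l : List E) :
    listTensor (n + 1) (f :: l) = TPow.succIso E n (f ⊗ₜ listTensor n l) := rfl

/-- In `listTensor` the exponent is independent of the list, so lists whose lengths are only
provably equal give tensors in the same space. -/
theorem tprod_get (l : List E) :
    AlgTensor.tprod (E := fun _ : Fin l.length => E) l.get = listTensor l.length l := by
  induction l with
  | nil => rfl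
  | cons f l ih =>
    refine Eq.trans ?_ (listTensor_cons l.length f l).symm
    rw [← ih]
    rfl

theorem inner_listTensor_zero (l l' : List E) :
    inner ℂ (listTensor 0 l) (listTensor 0 l') = 1 := by
  rw [listTensor, listTensor, AlgTensor.inner_tprod]
  simp

/-- Permutations of `Fin n`, acting on the last `n` elements of `Fin (n + 1)`. -/
noncomputable def permSucc (n : ℕ) : Equiv.Perm (Fin n) →* Equiv.Perm (Fin (n + 1)) :=
  Equiv.Perm.viaEmbeddingHom (Fin.succEmb n)

theorem permSucc_succ {n : ℕ} (π : Equiv.Perm (Fin n)) (x : Fin n) :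
    permSucc n π x.succ = (π x).succ :=
  Equiv.Perm.viaEmbedding_apply π (Fin.succEmb n) x

theorem permSucc_zero {n : ℕ} (π : Equiv.Perm (Fin n)) : permSucc n π 0 = 0 :=
  Equiv.Perm.viaEmbedding_apply_of_notMem π (Fin.succEmb n) 0 (by
    rintro ⟨x, hx⟩
    exact Fin.succ_ne_zero x hx)

theorem permSucc_injective (n : ℕ) : Function.Injective (permSucc n) := by
  intro π σ h
  ext x
  have := congrArg (fun τ : Equiv.Perm (Fin (n + 1)) => τ x.succ) h
  simp only [permSucc_succ] at this
  exact congrArg Fin.val (Fin.succ_injective _ this)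

theorem permSucc_swap (n k : ℕ) (h : k + 1 < n) :
    permSucc n (Equiv.swap ⟨k, by omega⟩ ⟨k + 1, h⟩) =
      Equiv.swap ⟨k + 1, by omega⟩ ⟨k + 1 + 1, by omega⟩ := by
  ext x
  refine Fin.cases ?_ (fun x => ?_) x
  · rw [permSucc_zero, Equiv.swap_apply_of_ne_of_ne] <;> simp [Fin.ext_iff]
  · rw [permSucc_succ]
    simp only [Equiv.swap_apply_def, Fin.ext_iff, Fin.val_succ]
    split_ifs <;> simp_all

/-- The cyclic permutation moving `k` to the front. -/
noncomputable def moveFront : (n : ℕ) → Fin (n + 1) → Equiv.Perm (Fin (n + 1))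
  | 0, _ => 1
  | n + 1, k => Fin.cases 1 (fun k => Equiv.swap 0 1 * permSucc (n + 1) (moveFront n k)) k

theorem moveFront_zero (n : ℕ) : moveFront n 0 = 1 := by
  cases n <;> rfl

theorem moveFront_succ (n : ℕ) (k : Fin (n + 1)) :
    moveFront (n + 1) k.succ = Equiv.swap 0 1 * permSucc (n + 1) (moveFront n k) := rfl

theorem moveFront_apply : ∀ (n : ℕ) (k : Fin (n + 1)), moveFront n k k = 0
  | 0, k => Subsingleton.elim (α := Fin 1) _ _
  | n + 1, k => by
    refine Fin.cases ?_ (fun k => ?_) k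
    · rw [moveFront_zero]; rfl
    · rw [moveFront_succ, Equiv.Perm.mul_apply, permSucc_succ, moveFront_apply n k]
      exact Equiv.swap_apply_right 0 1

/-- The product determines `k` as the preimage of 0, because `permSucc` fixes 0, and then determines
the other factor. Surjectivity follows by counting: n! · (n + 1) = (n + 1)!. -/
theorem moveFront_bijective (n : ℕ) :
    Function.Bijective fun x : Equiv.Perm (Fin n) × Fin (n + 1) =>
      permSucc n x.1 * moveFront n x.2 := by
  rw [Fintype.bijective_iff_injective_and_card]
  constructor
  · rintro ⟨π, k⟩ ⟨σ, l⟩ h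
    have hk : ∀ (π : Equiv.Perm (Fin n)) (k : Fin (n + 1)), (permSucc n π * moveFront n k) k = 0 := by
      intro π k
      rw [Equiv.Perm.mul_apply, moveFront_apply, permSucc_zero]
    obtain rfl : k = l := by
      refine (permSucc n σ * moveFront n l).injective ?_
      rw [hk]
      exact (congrArg (fun τ : Equiv.Perm (Fin (n + 1)) => τ k) h).symm.trans (hk π k)
    exact Prod.ext (permSucc_injective n (mul_right_cancel h)) rfl
  · simp [Fintype.card_perm, Nat.factorial_succ, mul_comm]

/-- `shift`, as a homomorphism. -/
noncomputable def shiftHom (n : ℕ) : (TPow E n ≃ₗᵢ[ℂ] TPow E n) →*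
    (TPow E (n + 1) ≃ₗᵢ[ℂ] TPow E (n + 1)) where
  toFun := shift
  map_one' := shift_one
  map_mul' := shift_mul

/-- Both sides are homomorphisms in `π`, and they agree on the adjacent transpositions, which
generate. -/
theorem permRep_permSucc (S : InvRMatrix E) (n : ℕ) (π : Equiv.Perm (Fin n)) :
    permRep S (n + 1) (permSucc n π) = shift (permRep S n π) := by
  suffices h : (permRep S (n + 1)).comp (permSucc n) = (shiftHom n).comp (permRep S n) from
    DFunLike.congr_fun h π
  cases n with
  | zero => ext π; rw [Subsingleton.elim π 1, map_one, map_one]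
  | succ n =>
    refine MonoidHom.eq_of_eqOn_denseM (Equiv.Perm.mclosure_swap_castSucc_succ n) ?_
    rintro _ ⟨i, rfl⟩
    have h : Equiv.swap i.castSucc i.succ =
        Equiv.swap (⟨i, by omega⟩ : Fin (n + 1)) ⟨i + 1, by omega⟩ := rfl
    change permRep S (n + 1 + 1) (permSucc (n + 1) (Equiv.swap i.castSucc i.succ)) =
      shift (permRep S (n + 1) (Equiv.swap i.castSucc i.succ))
    rw [h, permSucc_swap _ _ (by omega), permRep_swap, permRep_swap, leg_succ_succ]

theorem shift_succIso {n : ℕ} (A : TPow E n ≃ₗᵢ[ℂ] TPow E n) (f : E) (t : TPow E n) :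
    shift A (TPow.succIso E n (f ⊗ₜ t)) = TPow.succIso E n (f ⊗ₜ A t) := by
  simp [shift]

theorem permRep_moveFront_succ (S : InvRMatrix E) (n : ℕ) (k : Fin (n + 1)) :
    permRep S (n + 2) (moveFront (n + 1) k.succ) =
      firstLeg S.op n * shift (permRep S (n + 1) (moveFront n k)) := by
  rw [moveFront_succ, map_mul, permRep_permSucc]
  congr 1
  exact permRep_swap S (n + 2) 0 (by omega)

section moves
variable {X : Type*} {J : X → E} {exch : X → X → ℂ × X × X} {S : InvRMatrix E}

theorem firstLeg_listTensor
    (hJ : ∀ f h, S.op (J f ⊗ₜ J h) = (exch f h).1 • (J (exch f h).2.1 ⊗ₜ J (exch f h).2.2))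
    (n : ℕ) (f h : X) (t : TPow E n) :
    firstLeg S.op n (TPow.succIso E (n + 1) (J f ⊗ₜ TPow.succIso E n (J h ⊗ₜ t))) =
      (exch f h).1 • TPow.succIso E (n + 1)
        (J (exch f h).2.1 ⊗ₜ TPow.succIso E n (J (exch f h).2.2 ⊗ₜ t)) := by
  have h1 : ∀ a b : E, TPow.succIso E (n + 1) (a ⊗ₜ TPow.succIso E n (b ⊗ₜ t)) =
      twoIso n (TensorProduct.assoc ℂ E E (TPow E n) ((a ⊗ₜ b) ⊗ₜ t)) := fun _ _ => rfl
  rw [h1, firstLeg_apply, leftLeg_tmul, hJ, h1, ← TensorProduct.smul_tmul', map_smul, map_smul]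

/-- This is 1 + S₁ + S₁S₂ + ⋯ evaluated on an elementary tensor. The terms after the first are S₁
applied to 1 ⊗ (the same sum on one factor fewer), which matches the recursion of `moves`. -/
theorem sum_moveFront_listTensor
    (hJ : ∀ f h, S.op (J f ⊗ₜ J h) = (exch f h).1 • (J (exch f h).2.1 ⊗ₜ J (exch f h).2.2)) :
    ∀ (n : ℕ) (l : List X) (_ : l.length = n + 1),
      ∑ k, permRep S (n + 1) (moveFront n k) (listTensor (n + 1) (l.map J)) =
        ((moves exch l).map fun m =>
          m.1 • TPow.succIso E n (J m.2.1 ⊗ₜ listTensor n (m.2.2.map J))).sum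
  | _, [], h => by simp at h
  | 0, [f], _ => by
    simp [moveFront, moves, listTensor]
  | 0, _ :: _ :: _, h => by simp at h
  | n + 1, f :: l, h => by
    rw [Fin.sum_univ_succ, moveFront_zero, map_one, moves, List.map_cons, List.map_cons,
      List.sum_cons, listTensor_cons, one_smul]
    refine congrArg₂ _ rfl ?_
    simp only [permRep_moveFront_succ, LinearIsometryEquiv.coe_mul, Function.comp_apply,
      shift_succIso]
    rw [← map_sum, ← map_sum, ← TensorProduct.tmul_sum,
      sum_moveFront_listTensor hJ n l (by simpa using h), List.map_map]
    -- What remains is linear in the terms, so it holds for any list of terms in place of `moves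
    -- exch l`.
    induction moves exch l with
    | nil => simp
    | cons m M ih =>
      rw [List.map_cons, List.map_cons, List.sum_cons, List.sum_cons, TensorProduct.tmul_add,
        map_add, map_add, ih, TensorProduct.tmul_smul, map_smul, map_smul,
        firstLeg_listTensor hJ, smul_smul]
      rfl

/-- With π split into a permutation of the last n factors and a move to the front, the first factor
contributes ⟨g, ·⟩ and the inner sum is the same statement for one factor fewer. -/
theorem sum_inner_permRep
    (hJ : ∀ f h, S.op (J f ⊗ₜ J h) = (exch f h).1 • (J (exch f h).2.1 ⊗ₜ J (exch f h).2.2)) :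
    ∀ (n : ℕ) (g l : List X) (_ : g.length = n) (_ : l.length = n),
      ∑ π, inner ℂ (listTensor n (g.map J)) (permRep S n π (listTensor n (l.map J))) =
        fockKernel (fun p q => inner ℂ (J p) (J q)) exch g l
  | 0, [], [], _, _ => by
    rw [Fintype.sum_unique, Subsingleton.elim default (1 : Equiv.Perm (Fin 0)), map_one,
      LinearIsometryEquiv.coe_one, id, inner_listTensor_zero, fockKernel]
  | 0, _ :: _, _, h, _ => by simp at h
  | 0, _, _ :: _, _, h => by simp at h
  | n + 1, [], _, h, _ => by simp at h
  | n + 1, g :: g', l, hg, hl => by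
    rw [← (moveFront_bijective n).sum_comp, Fintype.sum_prod_type, fockKernel_cons,
      List.map_cons, listTensor_cons]
    simp only [map_mul, LinearIsometryEquiv.coe_mul, Function.comp_apply, permRep_permSucc,
      ← inner_sum, ← map_sum, sum_moveFront_listTensor hJ n l hl]
    have ih := fun m (hm : m ∈ moves exch l) => sum_inner_permRep hJ n g' m.2.2 (by simpa using hg)
      (by have := length_of_mem_moves exch hm; omega)
    -- The induction hypothesis needs remainders of length `n`, hence it is carried along for the
    -- members of the list of terms only.
    revert ih
    induction moves exch l with
    | nil => simp
    | cons m M ihM =>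
      intro ih
      simp only [List.map_cons, List.sum_cons, map_add, inner_add_right, Finset.sum_add_distrib] at ihM ⊢
      rw [ihM fun m hm => ih m (List.mem_cons_of_mem _ hm)]
      congr 1
      rw [← ih m List.mem_cons_self, Finset.mul_sum, Finset.mul_sum, inner_sum]
      refine Finset.sum_congr rfl fun π _ => ?_
      rw [map_smul, inner_smul_right, shift_succIso, LinearIsometryEquiv.inner_map_map,
        TensorProduct.inner_tmul]

end moves
end tensor

/-! ### Total families, unitaries between them, and totality of elementary tensors. -/

section total
variable {V W : Type*} [NormedAddCommGroup V] [InnerProductSpace ℂ V]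
  [NormedAddCommGroup W] [InnerProductSpace ℂ W]

theorem map_mem_of_total {s : Set V} (hs : (Submodule.span ℂ s).topologicalClosure = ⊤)
    (A : V →L[ℂ] W) {K : Submodule ℂ W} (hK : IsClosed (K : Set W)) (h : ∀ x ∈ s, A x ∈ K) (x : V) :
    A x ∈ K := by
  have h1 : Submodule.span ℂ s ≤ K.comap A.toLinearMap := Submodule.span_le.mpr h
  have h2 : (Submodule.span ℂ s).topologicalClosure ≤ K.comap A.toLinearMap :=
    Submodule.topologicalClosure_minimal _ h1 (hK.preimage A.continuous)
  exact h2 (hs ▸ Submodule.mem_top)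

/-- Total families with the same inner products are related by a unitary. -/
theorem exists_unitary_of_inner_eq [CompleteSpace V] [CompleteSpace W] {X : Type*} (a : X → V)
    (b : X → W) (ha : (Submodule.span ℂ (Set.range a)).topologicalClosure = ⊤)
    (hb : (Submodule.span ℂ (Set.range b)).topologicalClosure = ⊤)
    (h : ∀ x y, inner ℂ (a x) (a y) = inner ℂ (b x) (b y)) :
    ∃ U : V ≃ₗᵢ[ℂ] W, ∀ x, U (a x) = b x := by
  let α := Finsupp.linearCombination ℂ a
  let β := Finsupp.linearCombination ℂ b
  have hα : DenseRange α := by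
    have : Set.range α = (Submodule.span ℂ (Set.range a) : Set V) := by
      rw [← Finsupp.range_linearCombination]; rfl
    rw [DenseRange, this]
    exact (Submodule.dense_iff_topologicalClosure_eq_top).mpr ha
  -- Equal Gram matrices give equal norms of finite linear combinations. Hence `α c ↦ β c` is well
  -- defined and isometric on a dense subspace.
  have hi : ∀ c d, inner ℂ (α c) (α d) = inner ℂ (β c) (β d) := by
    intro c d
    simp only [α, β, Finsupp.linearCombination_apply, Finsupp.sum, sum_inner, inner_sum,
      inner_smul_left, inner_smul_right, h]
  have hn : ∀ c, ‖β c‖ = ‖α c‖ := by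
    intro c
    rw [@norm_eq_sqrt_re_inner ℂ, @norm_eq_sqrt_re_inner ℂ, hi]
  let U := β.extendOfNorm α
  have hU : ∀ c, U (α c) = β c :=
    LinearMap.extendOfNorm_eq hα ⟨1, fun c => by rw [hn, one_mul]⟩
  let U' : V →ₗᵢ[ℂ] W := ⟨U.toLinearMap, fun x => hα.induction_on (p := fun x => ‖U x‖ = ‖x‖) x
    (isClosed_eq (by fun_prop) (by fun_prop)) fun c => by rw [hU, hn]⟩
  have hU' : ∀ x, U' (a x) = b x := by
    intro x
    have := hU (Finsupp.single x 1)
    exact (by simpa [α, β] using this : U (a x) = b x)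
  have hsurj : Function.Surjective U' := by
    -- The range of an isometry on a complete space is closed, and this one contains the total
    -- family `b`.
    have hc : IsClosed (U'.toLinearMap.range : Set W) := by
      rw [LinearMap.coe_range]
      exact U'.isometry.isClosedEmbedding.isClosed_range
    intro w
    refine map_mem_of_total hb (ContinuousLinearMap.id ℂ W) hc ?_ w
    rintro _ ⟨x, rfl⟩
    exact ⟨a x, hU' x⟩
  exact ⟨LinearIsometryEquiv.ofSurjective U' hsurj, hU'⟩

end total

/-- The tensor product is continuous in each argument separately, so the factors can be approximated
one after the other. -/
theorem AlgTensor.total : ∀ {n : ℕ} {E : Fin n → Type u} [∀ i, NormedAddCommGroup (E i)]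
    [∀ i, InnerProductSpace ℂ (E i)] (s : ∀ i, Set (E i))
    (_ : ∀ i, (Submodule.span ℂ (s i)).topologicalClosure = ⊤),
    (Submodule.span ℂ {t : AlgTensor E | ∃ x, (∀ i, x i ∈ s i) ∧ AlgTensor.tprod x = t}).topologicalClosure
      = ⊤
  | 0, E, _, _, s, _ => by
    refine Submodule.eq_top_iff'.mpr fun (z : EuclideanSpace ℂ PUnit) => ?_
    have hz : z = z PUnit.unit • EuclideanSpace.single PUnit.unit (1 : ℂ) := by
      ext i; simp
    rw [hz]
    refine Submodule.smul_mem _ _ (Submodule.le_topologicalClosure _ (Submodule.subset_span ?_))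
    exact ⟨fun i => i.elim0, fun i => i.elim0, rfl⟩
  | n + 1, E, _, _, s, hs => by
    set K := (Submodule.span ℂ
      {t : AlgTensor E | ∃ x, (∀ i, x i ∈ s i) ∧ AlgTensor.tprod x = t}).topologicalClosure
    have hKc : IsClosed (K : Set (AlgTensor E)) := Submodule.isClosed_topologicalClosure _
    let T := AlgTensor fun i : Fin n => E i.succ
    let B : E 0 →L[ℂ] T →L[ℂ] (E 0 ⊗[ℂ] T) := TensorProduct.mkL ℂ (E 0) T
    let σ : (E 0 ⊗[ℂ] T) →L[ℂ] AlgTensor E := (AlgTensor.succIso E).toContinuousLinearEquiv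
    have h1 : ∀ a ∈ s 0, ∀ b, σ (B a b) ∈ K := by
      intro a ha
      refine map_mem_of_total (AlgTensor.total (fun i : Fin n => s i.succ) fun i => hs i.succ)
        (σ.comp (B a)) hKc ?_
      rintro _ ⟨x, hx, rfl⟩
      refine Submodule.le_topologicalClosure _ (Submodule.subset_span ?_)
      exact ⟨Fin.cons a x, fun i => Fin.cases ha hx i, rfl⟩
    -- The second argument is already arbitrary; now it is fixed and the first one leaves `s 0`.
    have h2 : ∀ a b, σ (B a b) ∈ K := by
      intro a b
      exact map_mem_of_total (hs 0) (σ.comp (B.flip b)) hKc (fun a ha => h1 a ha b) a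
    refine Submodule.eq_top_iff'.mpr fun z => ?_
    obtain ⟨z, rfl⟩ := (AlgTensor.succIso E).surjective z
    induction z using TensorProduct.induction_on with
    | zero => rw [map_zero]; exact K.zero_mem
    | add a b ha hb => rw [map_add]; exact K.add_mem ha hb
    | tmul a b => exact h2 a b

theorem HilbTensor.total {n : ℕ} {E : Fin n → Type u} [∀ i, NormedAddCommGroup (E i)]
    [∀ i, InnerProductSpace ℂ (E i)] (s : ∀ i, Set (E i))
    (hs : ∀ i, (Submodule.span ℂ (s i)).topologicalClosure = ⊤) :
    (Submodule.span ℂ {t : HilbTensor E | ∃ x, (∀ i, x i ∈ s i) ∧ HilbTensor.tprod x = t}).topologicalClosure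
      = ⊤ := by
  set K := (Submodule.span ℂ
    {t : HilbTensor E | ∃ x, (∀ i, x i ∈ s i) ∧ HilbTensor.tprod x = t}).topologicalClosure
  have hKc : IsClosed (K : Set (HilbTensor E)) := Submodule.isClosed_topologicalClosure _
  refine Submodule.eq_top_iff'.mpr fun z => ?_
  refine UniformSpace.Completion.denseRange_coe.induction_on (p := fun z => z ∈ K) z hKc fun t => ?_
  refine map_mem_of_total (AlgTensor.total s hs) UniformSpace.Completion.toComplL hKc ?_ t
  rintro _ ⟨x, hx, rfl⟩
  exact Submodule.le_topologicalClosure _ (Submodule.subset_span ⟨x, hx, rfl⟩)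

theorem HilbTensor.inner_tprod {n : ℕ} {E : Fin n → Type u} [∀ i, NormedAddCommGroup (E i)]
    [∀ i, InnerProductSpace ℂ (E i)] (x y : ∀ i, E i) :
    inner ℂ (HilbTensor.tprod x) (HilbTensor.tprod y) = ∏ i, inner ℂ (x i) (y i) := by
  rw [HilbTensor.tprod, HilbTensor.tprod, UniformSpace.Completion.inner_coe, AlgTensor.inner_tprod]

/-! ### Inner products and totality of the Fock vectors. -/

section fock
variable {E : Type u} [NormedAddCommGroup E] [InnerProductSpace ℂ E] (S : InvRMatrix E)

theorem symProj_apply (n : ℕ) (x : TPow E n) :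
    symProj S n x = (n.factorial : ℂ)⁻¹ • ∑ π, permRep S n π x := by
  simp [symProj]

theorem permRep_symProj (n : ℕ) (σ : Equiv.Perm (Fin n)) (x : TPow E n) :
    permRep S n σ (symProj S n x) = symProj S n x := by
  simp only [symProj_apply, map_smul, map_sum]
  congr 1
  refine Fintype.sum_equiv (Equiv.mulLeft σ) _ _ fun π => ?_
  rw [Equiv.coe_mulLeft, map_mul]
  rfl

theorem symProj_symProj (n : ℕ) (x : TPow E n) : symProj S n (symProj S n x) = symProj S n x := by
  rw [symProj_apply S n (symProj S n x)]
  simp only [permRep_symProj, Finset.sum_const, Finset.card_univ, Fintype.card_perm,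
    Fintype.card_fin]
  rw [← Nat.cast_smul_eq_nsmul ℂ, smul_smul, inv_mul_cancel₀, one_smul]
  exact_mod_cast n.factorial_ne_zero

/-- Each D(π) is unitary and fixes P y, so ⟨D(π) x, P y⟩ = ⟨x, P y⟩; averaging over π gives ⟨P x, P
y⟩ = ⟨x, P y⟩. -/
theorem inner_symProj_symProj (n : ℕ) (x y : TPow E n) :
    inner ℂ (symProj S n x) (symProj S n y) =
      (n.factorial : ℂ)⁻¹ * ∑ π, inner ℂ x (permRep S n π y) := by
  have h : ∀ π, inner ℂ (permRep S n π x) (symProj S n y) = inner ℂ x (symProj S n y) := by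
    intro π
    conv_lhs => rw [← permRep_symProj S n π y]
    exact LinearIsometryEquiv.inner_map_map _ _ _
  have h0 : (n.factorial : ℂ) ≠ 0 := by exact_mod_cast n.factorial_ne_zero
  rw [symProj_apply S n x, inner_smul_left, sum_inner]
  simp only [h, Finset.sum_const, Finset.card_univ, Fintype.card_perm, Fintype.card_fin,
    nsmul_eq_mul, map_inv₀, map_natCast]
  rw [inv_mul_cancel_left₀ h0, symProj_apply, inner_smul_right, inner_sum]

/-- The range of a continuous idempotent is closed. This makes the n-particle spaces, and with them
the Fock space, complete, which the construction of the unitary requires. -/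
theorem completion_symProj_idem (n : ℕ) : IsIdempotentElem (symProj S n).completion := by
  ext x
  refine UniformSpace.Completion.denseRange_coe.induction_on
    (p := fun x => ((symProj S n).completion * (symProj S n).completion) x =
      (symProj S n).completion x) x
    (isClosed_eq (ContinuousLinearMap.continuous _) (ContinuousLinearMap.continuous _)) fun t => ?_
  change (symProj S n).completion ((symProj S n).completion t) = _
  rw [ContinuousLinearMap.completion_apply_coe, ContinuousLinearMap.completion_apply_coe,
    symProj_symProj]

instance completeSpace_symSpace (n : ℕ) : CompleteSpace (symSpace S n) :=
  (ContinuousLinearMap.IsIdempotentElem.isClosed_range (completion_symProj_idem S n)).completeSpace_coe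

/-- The operator `P_n`, from the `n`-th Hilbert space tensor power to the Fock space. -/
noncomputable def toFock (n : ℕ) : HilbTensor (fun _ : Fin n => E) →L[ℂ] Fock S :=
  (lp.singleContinuousLinearMap ℂ (fun n => symSpace S n) 2 n).comp
    ((symProj S n).completion.codRestrict (symSpace S n) fun x => LinearMap.mem_range_self (symProj S n).completion.toLinearMap x)

theorem vec_eq_toFock {n : ℕ} {l : List E} (h : l.length = n) :
    Fock.vec S l = (Real.sqrt n.factorial : ℂ) • toFock S n (listTensor n l : TPow E n) := by
  subst h
  rw [← tprod_get, toFock, ContinuousLinearMap.comp_apply, ← map_smul]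
  rfl

theorem inner_toFock (n : ℕ) (x y : TPow E n) :
    inner ℂ (toFock S n x) (toFock S n y) =
      (n.factorial : ℂ)⁻¹ * ∑ π, inner ℂ x (permRep S n π y) := by
  rw [← inner_symProj_symProj]
  rw [toFock, ContinuousLinearMap.comp_apply, ContinuousLinearMap.comp_apply,
    lp.singleContinuousLinearMap_apply, lp.singleContinuousLinearMap_apply,
    lp.inner_single_left, lp.single_apply_self, Submodule.coe_inner]
  change inner ℂ ((symProj S n).completion x) ((symProj S n).completion y) = _
  rw [ContinuousLinearMap.completion_apply_coe, ContinuousLinearMap.completion_apply_coe,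
    UniformSpace.Completion.inner_coe]

theorem inner_toFock_ne {n m : ℕ} (h : n ≠ m) (x : HilbTensor (fun _ : Fin n => E))
    (y : HilbTensor (fun _ : Fin m => E)) : inner ℂ (toFock S n x) (toFock S m y) = 0 := by
  rw [toFock, toFock, ContinuousLinearMap.comp_apply, ContinuousLinearMap.comp_apply,
    lp.singleContinuousLinearMap_apply, lp.singleContinuousLinearMap_apply,
    lp.inner_single_left, lp.single_apply_ne _ _ _ h, inner_zero_right]

/-- For equal lengths the two factors √(n!) cancel the 1/n! of the projection and leave the bare sum
over permutations. For different lengths both sides vanish. -/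
theorem inner_vec {X : Type*} {J : X → E} {exch : X → X → ℂ × X × X}
    (hJ : ∀ f h, S.op (J f ⊗ₜ J h) = (exch f h).1 • (J (exch f h).2.1 ⊗ₜ J (exch f h).2.2))
    (g l : List X) :
    inner ℂ (Fock.vec S (g.map J)) (Fock.vec S (l.map J)) =
      fockKernel (fun p q => inner ℂ (J p) (J q)) exch g l := by
  rcases eq_or_ne g.length l.length with h | h
  · rw [vec_eq_toFock S (n := l.length) (by simp [h]), vec_eq_toFock S (n := l.length) (by simp),
      inner_smul_left, inner_smul_right, inner_toFock, sum_inner_permRep hJ _ _ _ h rfl,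
      Complex.conj_ofReal, ← mul_assoc, ← mul_assoc, ← Complex.ofReal_mul,
      Real.mul_self_sqrt (Nat.cast_nonneg _), Complex.ofReal_natCast, mul_inv_cancel₀, one_mul]
    exact_mod_cast l.length.factorial_ne_zero
  · rw [fockKernel_of_length_ne _ _ h, vec_eq_toFock S rfl, vec_eq_toFock S rfl, inner_smul_left,
      inner_smul_right, inner_toFock_ne S (by simpa using h), mul_zero, mul_zero]

theorem tprod_ofFn : ∀ (n : ℕ) (x : Fin n → E),
    AlgTensor.tprod (E := fun _ : Fin n => E) x = listTensor n (List.ofFn x)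
  | 0, x => by rw [listTensor]; congr; funext i; exact i.elim0
  | n + 1, x => by
    rw [List.ofFn_succ, listTensor_cons, ← tprod_ofFn n]
    rfl

/-- Tensors of vectors `J x` are total in each tensor power, and `toFock` sends them to multiples of
Fock vectors. -/
theorem total_vec {X : Type*} {J : X → E}
    (hJ : (Submodule.span ℂ (Set.range J)).topologicalClosure = ⊤) :
    (Submodule.span ℂ (Set.range fun l : List X => Fock.vec S (l.map J))).topologicalClosure = ⊤ := by
  set K := (Submodule.span ℂ
    (Set.range fun l : List X => Fock.vec S (l.map J))).topologicalClosure
  have hKc : IsClosed (K : Set (Fock S)) := Submodule.isClosed_topologicalClosure _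
  have h1 : ∀ n x, toFock S n x ∈ K := by
    intro n
    refine map_mem_of_total (HilbTensor.total (fun _ : Fin n => Set.range J) fun _ => hJ) _ hKc ?_
    rintro _ ⟨x, hx, rfl⟩
    choose y hy using hx
    have h2 : toFock S n (HilbTensor.tprod x) =
        (Real.sqrt n.factorial : ℂ)⁻¹ • Fock.vec S ((List.ofFn y).map J) := by
      rw [vec_eq_toFock S (n := n) (by simp), smul_smul, inv_mul_cancel₀, one_smul, List.map_ofFn,
        show J ∘ y = x from funext hy, ← tprod_ofFn]
      · rfl
      · rw [ne_eq, Complex.ofReal_eq_zero, Real.sqrt_eq_zero (Nat.cast_nonneg _)]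
        exact_mod_cast n.factorial_ne_zero
    rw [h2]
    exact K.smul_mem _ (Submodule.le_topologicalClosure _ (Submodule.subset_span ⟨_, rfl⟩))
  refine Submodule.eq_top_iff'.mpr fun f => ?_
  -- A vector of the Fock space is the sum of its n-particle components, and each component lies in
  -- the range of P_n, hence comes from `toFock`.
  refine hKc.mem_of_tendsto (lp.hasSum_single (by norm_num) f)
    (Filter.Eventually.of_forall fun s => K.sum_mem fun n _ => ?_)
  obtain ⟨x, hx⟩ := (f n).2
  have : f n = (symProj S n).completion.codRestrict (symSpace S n)
    (fun x => LinearMap.mem_range_self (symProj S n).completion.toLinearMap x) x := Subtype.ext hx.symm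
  rw [this]
  exact h1 n x

end fock

/-! ### Additivity in each entry and reduction to elementary tensors. -/

section additive

/-- The entries are decomposed from the right: `p` is still arbitrary, while `q` already consists of
elementary tensors. -/
theorem tmul_list_induction {ι : Type*} {A : ι → Type*} [∀ i, NormedAddCommGroup (A i)]
    [∀ i, InnerProductSpace ℂ (A i)] {B : Type*} [NormedAddCommGroup B] [InnerProductSpace ℂ B]
    {P : List (Σ i, A i ⊗[ℂ] B) → Prop}
    (hadd : ∀ p j a b q, P (p ++ ⟨j, a⟩ :: q) → P (p ++ ⟨j, b⟩ :: q) → P (p ++ ⟨j, a + b⟩ :: q))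
    (htmul : ∀ l : List (Σ i, A i × B), P (l.map fun x => ⟨x.1, x.2.1 ⊗ₜ x.2.2⟩))
    (l : List (Σ i, A i ⊗[ℂ] B)) : P l := by
  suffices key : ∀ (p : List (Σ i, A i ⊗[ℂ] B)) (q : List (Σ i, A i × B)),
      P (p ++ q.map fun x => ⟨x.1, x.2.1 ⊗ₜ x.2.2⟩) by
    simpa using key l []
  intro p
  induction p using List.reverseRecOn with
  | nil => simpa using htmul
  | append_singleton p f ih =>
    intro q
    obtain ⟨j, f⟩ := f
    rw [List.append_assoc, List.singleton_append]
    induction f using TensorProduct.induction_on with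
    -- Zero is the elementary tensor 0 ⊗ 0, so additivity and elementary tensors suffice as
    -- hypotheses.
    | zero => simpa using ih (⟨j, 0, 0⟩ :: q)
    | add a b ha hb => exact hadd _ _ _ _ _ ha hb
    | tmul a b => exact ih (⟨j, a, b⟩ :: q)

/-- Three families that agree away from `j` are used instead of updates of one family, since in the
application they are families of Fock vectors of sublists. -/
theorem AlgTensor.tprod_add : ∀ {n : ℕ} {E : Fin n → Type u} [∀ i, NormedAddCommGroup (E i)]
    [∀ i, InnerProductSpace ℂ (E i)] (x y z : ∀ i, E i) (j : Fin n) (_ : z j = x j + y j)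
    (_ : ∀ i, i ≠ j → x i = z i) (_ : ∀ i, i ≠ j → y i = z i),
    AlgTensor.tprod z = AlgTensor.tprod x + AlgTensor.tprod y
  | 0, _, _, _, _, _, _, j, _, _, _ => j.elim0
  | n + 1, E, _, _, x, y, z, j, hj, hx, hy => by
    simp only [AlgTensor.tprod]
    rw [← map_add]
    congr 1
    refine Fin.cases (fun hj hx hy => ?_) (fun j hj hx hy => ?_) j hj hx hy
    · have h1 : (fun i : Fin n => x i.succ) = fun i : Fin n => z i.succ :=
        funext fun i => hx _ (Fin.succ_ne_zero i)
      have h2 : (fun i : Fin n => y i.succ) = fun i : Fin n => z i.succ :=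
        funext fun i => hy _ (Fin.succ_ne_zero i)
      rw [h1, h2, hj, TensorProduct.add_tmul]
    · rw [hx 0 (Fin.succ_ne_zero j).symm, hy 0 (Fin.succ_ne_zero j).symm, ← TensorProduct.tmul_add,
        AlgTensor.tprod_add (fun i : Fin n => x i.succ) (fun i => y i.succ) (fun i => z i.succ) j hj
          (fun i hi => hx _ fun h => hi (Fin.succ_injective _ h))
          (fun i hi => hy _ fun h => hi (Fin.succ_injective _ h))]

theorem HilbTensor.tprod_add {n : ℕ} {E : Fin n → Type u} [∀ i, NormedAddCommGroup (E i)]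
    [∀ i, InnerProductSpace ℂ (E i)] (x y z : ∀ i, E i) (j : Fin n) (hj : z j = x j + y j)
    (hx : ∀ i, i ≠ j → x i = z i) (hy : ∀ i, i ≠ j → y i = z i) :
    HilbTensor.tprod z = HilbTensor.tprod x + HilbTensor.tprod y := by
  rw [HilbTensor.tprod, AlgTensor.tprod_add x y z j hj hx hy]
  exact UniformSpace.Completion.coe_add _ _

variable {E : Type u} [NormedAddCommGroup E] [InnerProductSpace ℂ E]

/-- The bound on the length of `p` places the varying entry among the first `n`; later entries are
ignored by `listTensor`. -/
theorem listTensor_add (a b : E) (q : List E) : ∀ (n : ℕ) (p : List E), p.length < n →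
    listTensor n (p ++ (a + b) :: q) = listTensor n (p ++ a :: q) + listTensor n (p ++ b :: q)
  | 0, _, h => by omega
  | n + 1, [], _ => by
    simp only [List.nil_append, listTensor_cons, TensorProduct.add_tmul, map_add]
  | n + 1, f :: p, h => by
    simp only [List.cons_append, listTensor_cons]
    rw [listTensor_add a b q n p (by simpa using h), TensorProduct.tmul_add, map_add]

theorem vec_add (S : InvRMatrix E) (p : List E) (a b : E) (q : List E) :
    Fock.vec S (p ++ (a + b) :: q) = Fock.vec S (p ++ a :: q) + Fock.vec S (p ++ b :: q) := by
  have h : ∀ c, (p ++ c :: q).length = p.length + q.length + 1 := fun c => by simp; omega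
  rw [vec_eq_toFock S (h _), vec_eq_toFock S (h a), vec_eq_toFock S (h b),
    listTensor_add a b q _ p (by omega), UniformSpace.Completion.coe_add, map_add, smul_add]

end additive

/-! ### The box-product with the flip on elementary tensors. -/

section tilde
variable {H : Type u} {L : Type v} [NormedAddCommGroup H] [InnerProductSpace ℂ H]
  [NormedAddCommGroup L] [InnerProductSpace ℂ L]

/-- The `L`-factors are always exchanged, whatever `S` does to the `H`-factors. For `S = ± 1` this
mixes the two vectors into x ⊗ l and y ⊗ k, so an exchange rule on labels is available for
elementary tensors x ⊗ k but not for general vectors of `H ⊗ L`. -/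
theorem tilde_op_tmul (S : InvRMatrix H) {x y x' y' : H} {c : ℂ}
    (h : S.op (x ⊗ₜ y) = c • (x' ⊗ₜ y')) (k l : L) :
    (S.tilde L).op ((x ⊗ₜ k) ⊗ₜ (y ⊗ₜ l)) = c • ((x' ⊗ₜ l) ⊗ₜ (y' ⊗ₜ k)) := by
  change boxProdOp S.op (InvRMatrix.flip L).op ((middleSwap H L).symm ((x ⊗ₜ y) ⊗ₜ (k ⊗ₜ l))) = _
  rw [boxProdOp_symm, h, ← TensorProduct.smul_tmul', map_smul]
  rfl

end tilde

/-! ### The normal form: exchange rules, factorised inner products and the unitary. -/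

section family
variable {N : ℕ} {H : Fin N → Type u} [∀ i, NormedAddCommGroup (H i)]
  [∀ i, InnerProductSpace ℂ (H i)] {L : Type v} [NormedAddCommGroup L] [InnerProductSpace ℂ L]
  (ε : Fin N → ℤˣ)

/-- The exchange of elementary tensors by the box-product of `ε i` and the flip. -/
def signExch (i : Fin N) (p q : H i × L) : ℂ × (H i × L) × (H i × L) :=
  (((ε i : ℤ) : ℂ), (p.1, q.2), (q.1, p.2))

/-- The exchange of elementary tensors by the box-product of a normal form and the flip. -/
def normalExch (p q : Σ i, H i × L) : ℂ × (Σ i, H i × L) × (Σ i, H i × L) :=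
  if p.1 = q.1 then (((ε p.1 : ℤ) : ℂ), ⟨p.1, p.2.1, q.2.2⟩, ⟨q.1, q.2.1, p.2.2⟩) else (1, q, p)

/-- The elementary tensors `x ⊗ k` with `x` in one of the summands. -/
noncomputable def inclTmul (p : Σ i, H i × L) : PiLp 2 H ⊗[ℂ] L := incl H p.1 p.2.1 ⊗ₜ p.2.2

theorem sign_tilde_op (i : Fin N) (p q : H i × L) :
    ((InvRMatrix.sign (H i) (ε i)).tilde L).op ((p.1 ⊗ₜ p.2) ⊗ₜ (q.1 ⊗ₜ q.2)) =
      (signExch ε i p q).1 • (((signExch ε i p q).2.1.1 ⊗ₜ (signExch ε i p q).2.1.2) ⊗ₜ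
        ((signExch ε i p q).2.2.1 ⊗ₜ (signExch ε i p q).2.2.2)) :=
  tilde_op_tmul _ (InvRMatrix.signOp_apply (ε i) (p.1 ⊗ₜ q.1)) p.2 q.2

theorem normal_tilde_op (p q : Σ i, H i × L) :
    ((InvRMatrix.boxSum fun i => InvRMatrix.sign (H i) (ε i)).tilde L).op
        (inclTmul p ⊗ₜ inclTmul q) =
      (normalExch ε p q).1 • (inclTmul (normalExch ε p q).2.1 ⊗ₜ inclTmul (normalExch ε p q).2.2) := by
  obtain ⟨i, p⟩ := p
  obtain ⟨j, q⟩ := q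
  rcases eq_or_ne i j with rfl | h
  · rw [normalExch, if_pos rfl]
    refine tilde_op_tmul _ ?_ p.2 q.2
    change boxSumOp _ (incl₂ H i (p.1 ⊗ₜ q.1)) = _
    rw [boxSumOp_incl₂]
    change incl₂ H i (((ε i : ℤ) : ℂ) • (p.1 ⊗ₜ q.1)) = _
    rw [map_smul]
    rfl
  · rw [normalExch, if_neg h]
    refine tilde_op_tmul _ ?_ p.2 q.2
    rw [one_smul]
    exact boxSumOp_ne _ h p.1 q.1

theorem total_inclTmul :
    (Submodule.span ℂ (Set.range (inclTmul (H := H) (L := L)))).topologicalClosure = ⊤ := by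
  refine top_le_iff.mp (le_trans ?_ (Submodule.le_topologicalClosure _))
  rw [← TensorProduct.span_tmul_eq_top, Submodule.span_le]
  rintro _ ⟨x, k, rfl⟩
  rw [← sum_incl x, TensorProduct.sum_tmul]
  exact Submodule.sum_mem _ fun i _ => Submodule.subset_span ⟨⟨i, x i, k⟩, rfl⟩

theorem total_tmul {H : Type u} [NormedAddCommGroup H] [InnerProductSpace ℂ H] :
    (Submodule.span ℂ (Set.range fun p : H × L => p.1 ⊗ₜ[ℂ] p.2)).topologicalClosure = ⊤ := by
  refine top_le_iff.mp (le_trans ?_ (Submodule.le_topologicalClosure _))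
  rw [← TensorProduct.span_tmul_eq_top, Submodule.span_le]
  rintro _ ⟨x, k, rfl⟩
  exact Submodule.subset_span ⟨(x, k), rfl⟩

theorem inner_vec_normal (g l : List (Σ i, H i × L)) :
    inner ℂ (Fock.vec ((InvRMatrix.boxSum fun i => InvRMatrix.sign (H i) (ε i)).tilde L)
        (g.map inclTmul))
      (Fock.vec ((InvRMatrix.boxSum fun i => InvRMatrix.sign (H i) (ε i)).tilde L)
        (l.map inclTmul)) =
      ∏ i, inner ℂ
        (Fock.vec ((InvRMatrix.sign (H i) (ε i)).tilde L)
          ((g.lookupAll i).map fun p => p.1 ⊗ₜ p.2))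
        (Fock.vec ((InvRMatrix.sign (H i) (ε i)).tilde L)
          ((l.lookupAll i).map fun p => p.1 ⊗ₜ p.2)) := by
  rw [inner_vec _ (normal_tilde_op ε)]
  simp only [inner_vec _ (sign_tilde_op ε _)]
  refine fockKernel_sigma ?_ ?_ ?_ ?_ g l
  · intro i p q
    rw [normalExch, if_pos rfl]
    rfl
  · intro i j h p q
    rw [normalExch, if_neg h]
  · intro i p q
    rw [inclTmul, inclTmul, TensorProduct.inner_tmul, TensorProduct.inner_tmul, inner_incl_same]
  · intro i j h p q
    rw [inclTmul, inclTmul, TensorProduct.inner_tmul, inner_incl_ne h, zero_mul]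

set_option maxHeartbeats 1000000 in
theorem exists_unitary_normal :
    ∃ V : Fock ((InvRMatrix.boxSum fun i => InvRMatrix.sign (H i) (ε i)).tilde L) ≃ₗᵢ[ℂ]
        HilbTensor fun i => Fock ((InvRMatrix.sign (H i) (ε i)).tilde L),
      ∀ l : List (Σ i, H i × L),
        V (Fock.vec ((InvRMatrix.boxSum fun i => InvRMatrix.sign (H i) (ε i)).tilde L)
            (l.map inclTmul)) =
        HilbTensor.tprod fun i => Fock.vec ((InvRMatrix.sign (H i) (ε i)).tilde L)
          ((l.lookupAll i).map fun p => p.1 ⊗ₜ[ℂ] p.2) := by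
  obtain ⟨V, hV⟩ := exists_unitary_of_inner_eq
    (fun l : List (Σ i, H i × L) => Fock.vec
      ((InvRMatrix.boxSum fun i => InvRMatrix.sign (H i) (ε i)).tilde L) (l.map inclTmul))
    (fun l : List (Σ i, H i × L) => HilbTensor.tprod fun i =>
      Fock.vec ((InvRMatrix.sign (H i) (ε i)).tilde L)
        ((l.lookupAll i).map fun p => p.1 ⊗ₜ[ℂ] p.2))
    (total_vec _ total_inclTmul) (by
      -- Tensor products of Fock vectors of independently chosen lists are total, and each of them
      -- belongs to the family because every choice of sublists comes from one list.
      rw [← top_le_iff, ← HilbTensor.total _ fun i =>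
        total_vec ((InvRMatrix.sign (H i) (ε i)).tilde L) total_tmul]
      refine Submodule.topologicalClosure_mono (Submodule.span_mono ?_)
      rintro _ ⟨x, hx, rfl⟩
      choose y hy using hx
      obtain ⟨l, hl⟩ := exists_lookupAll_eq y
      refine ⟨l, ?_⟩
      simp only [hl]
      exact congrArg HilbTensor.tprod (funext hy))
    (fun g l => by rw [inner_vec_normal, HilbTensor.inner_tprod])
  exact ⟨V, hV⟩

end family
end RFock

/-! ### The main theorem: extension from elementary tensors to all one-particle vectors. -/

set_option maxHeartbeats 1000000 in
theorem mainTheorem3 {N : ℕ} (H : Fin N → Type u) [∀ i, NormedAddCommGroup (H i)]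
    [∀ i, InnerProductSpace ℂ (H i)] [∀ i, FiniteDimensional ℂ (H i)]
    (L : Type v) [NormedAddCommGroup L] [InnerProductSpace ℂ L] [CompleteSpace L]
    (ε : Fin N → ℤˣ) (S : RFock.InvRMatrix (PiLp 2 H))
    (hS : S = RFock.InvRMatrix.boxSum fun i => RFock.InvRMatrix.sign (H i) (ε i)) :
    ∃ V : RFock.Fock (S.tilde L) ≃ₗᵢ[ℂ]
        RFock.HilbTensor fun i => RFock.Fock ((RFock.InvRMatrix.sign (H i) (ε i)).tilde L),
      ∀ l : List (Σ i, H i ⊗[ℂ] L),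
        V (RFock.Fock.vec (S.tilde L)
            (l.map fun f => (RFock.incl H f.1).toLinearMap.rTensor L f.2)) =
          RFock.HilbTensor.tprod fun i =>
            RFock.Fock.vec ((RFock.InvRMatrix.sign (H i) (ε i)).tilde L) (l.lookupAll i) := by
  subst hS
  obtain ⟨V, hV⟩ := RFock.exists_unitary_normal (H := H) (L := L) ε
  refine ⟨V, fun l => ?_⟩
  induction l using RFock.tmul_list_induction with
  | hadd p j a b q ha hb =>
    rw [List.map_append, List.map_cons] at ha hb ⊢
    rw [map_add, RFock.vec_add, map_add, ha, hb]
    -- An entry of index `j` occurs in the sublist of index `j` only, so a single tensor factor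
    -- varies, and it does so additively.
    refine (RFock.HilbTensor.tprod_add _ _ _ j ?_ (fun i hi => ?_) (fun i hi => ?_)).symm
    · simp only [RFock.lookupAll_append, List.lookupAll_cons_eq, RFock.vec_add]
    · simp only [RFock.lookupAll_append]
      rw [List.lookupAll_cons_ne _ _ hi, List.lookupAll_cons_ne _ _ hi]
    · simp only [RFock.lookupAll_append]
      rw [List.lookupAll_cons_ne _ _ hi, List.lookupAll_cons_ne _ _ hi]
  | htmul l =>
    rw [List.map_map]
    refine (hV l).trans ?_
    congr 1
    funext i
    rw [RFock.lookupAll_map (fun i (p : H i × L) => p.1 ⊗ₜ[ℂ] p.2)]
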